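/- **Theorem 2.** Let $l \neq p$ be primes, let $K/\mathbb{Q}_l$ be a finite extension with algebraic closure $\overline K$, absolute Galois group $G_K$ and inertia group $I_K$, and let $\mathbb{F}$ be a finite field of characteristic $p$ with ring of Witt vectors $W(\mathbb{F})$. Let $V_{\mathbb F}$ be a $d$-dimensional $\mathbb{F}$-vector space with a continuous linear action of $G_K$ and a basis $\beta_{\mathbb F}$. Let $R = R^{\Box}_{V_{\mathbb F}}$ be the universal framed deformation ring, i.e. the complete local Noetherian $W(\mathbb{F})$-algebra with residue field $\mathbb{F}$ that pro-represents the functor of framed deformations of $(V_{\mathbb F},\beta_{\mathbb F})$ on Artinian local $W(\mathbb{F})$-algebras with residue field $\mathbb{F}$, and let $\rho: G_K \to GL_d(R)$ be the universal framed deformation. Fix a continuous surjective homomorphism $t: I_K \to \mathbb{Z}_p$ and let $N \in M_d(R[1/p])$ be the universal monodromy operator: the nilpotent matrix with $\rho(\sigma) = \exp(t(\sigma)N)$ for all $\sigma$ in an open subgroup of $I_K$. Let $R^{\Box,N=0}_{V_{\mathbb F}} = R/J$, where $J$ is an ideal of $R$ whose extension to $R[1/p]$ is the ideal generated by the entries of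 $N$ (for instance the ideal of $R$ generated by the entries of $N$, if these lie in $R$), and suppose that this quotient is not zero. Let $L/K$ be a finite Galois extension inside $\overline K$ such that the action of $I_K$ on the universal deformation over $R^{\Box,N=0}_{V_{\mathbb F}}$ factors through the inertia group $I_{L/K}$ (that is, $I_L$ acts trivially). If the ramification index $e(L/K) = |I_{L/K}|$ is prime to $p$, then $R^{\Box,N=0}_{V_{\mathbb F}}$ is formally smooth over $W(\mathbb{F})$ of relative dimension $d^2$, i.e. isomorphic as a $W(\mathbb{F})$-algebra to $W(\mathbb{F})[[x_1,\dots,x_{d^2}]]$. -/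

import Mathlib

universe u

namespace FramedDef

/-! ### Local fields -/

section LocalFields

/-- The ring of integers of a finite extension `K` of `ℚ_l`: the integral closure of `ℤ_l` in `K`. -/
noncomputable def LocalIntegers (l : ℕ) [Fact l.Prime] (K : Type*) [Field K] [Algebra ℚ_[l] K] :
    Subring K :=
  (integralClosure (PadicInt.subring l) K).toSubring

/-- The ring of integers of an algebraic extension `E` of `K`: the integral closure in `E` of the
ring of integers of `K` (equivalently, of `ℤ_l`). -/
noncomputable abbrev ExtIntegers (l : ℕ) [Fact l.Prime] (K : Type*) [Field K] [Algebra ℚ_[l] K]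
    (E : Type*) [Field E] [Algebra K E] : Subalgebra (LocalIntegers l K) E :=
  integralClosure (LocalIntegers l K) E

/-- The maximal ideal of the ring of integers of an algebraic extension `E` of `K`. This ring is
local, so that its maximal ideal is its Jacobson radical. -/
noncomputable def extMaxIdeal (l : ℕ) [Fact l.Prime] (K : Type*) [Field K] [Algebra ℚ_[l] K]
    (E : Type*) [Field E] [Algebra K E] : Ideal (ExtIntegers l K E) :=
  Ideal.jacobson ⊥

/-- The ramification index `e(L/K)`. -/
noncomputable def ramIndex (l : ℕ) [Fact l.Prime] (K : Type*) [Field K] [Algebra ℚ_[l] K]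
    (L : Type*) [Field L] [Algebra K L] : ℕ :=
  (extMaxIdeal l K L).ramificationIdx (LocalIntegers l K)

variable (l : ℕ) [Fact l.Prime] (K : Type*) [Field K] [Algebra ℚ_[l] K]
  (Kbar : Type*) [Field Kbar] [Algebra K Kbar]

/-- The inertia group `I_K` in `G_K = Gal(Kbar/K)`: the automorphisms that act trivially on the
residue field of the ring of integers of `Kbar`. -/
noncomputable def inertia : Subgroup Gal(Kbar/K) :=
  (extMaxIdeal l K Kbar).inertia Gal(Kbar/K)

/-- The inertia group `I_L = I_K ∩ G_L` of an extension `L` of `K` inside `Kbar`. -/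
noncomputable def inertiaOver (L : IntermediateField K Kbar) : Subgroup Gal(Kbar/K) :=
  inertia l K Kbar ⊓ L.fixingSubgroup

end LocalFields

/-! ### Framed deformations -/

section Deformations

variable (p : ℕ) [Fact p.Prime] {𝔽 : Type u} [Field 𝔽]

/-- `π : A → 𝔽` makes the `W(𝔽)`-algebra `A` a local `W(𝔽)`-algebra with residue field `𝔽`:
`A` is local and `π` is a homomorphism of `W(𝔽)`-algebras (it is then surjective, and its kernel is
the maximal ideal of `A`). -/
structure IsLocalWittAlgebra {A : Type u} [CommRing A] [Algebra (WittVector p 𝔽) A] (π : A →+* 𝔽) :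
    Prop where
  isLocalRing : IsLocalRing A
  comp_eq : π.comp (algebraMap (WittVector p 𝔽) A) = WittVector.constantCoeff

variable {G : Type*} [Group G] [TopologicalSpace G]
  {V : Type*} [AddCommGroup V] [Module 𝔽 V] {d : ℕ}

/-- A framed deformation to `A` of the representation `ρbar` on the space `V` with basis `β`. The
framing identifies the deformation with `A^d`, so that an isomorphism class of framed
deformations is a continuous homomorphism `r : G → GL_d(A)` (a homomorphism to the
multiplicative monoid of matrices takes values in `GL_d(A)`) that reduces to the matrix of `ρbar`
in the basis `β`. Continuity is for the topology of `A` defined by the powers of the maximal ideal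
`ker π` (the discrete one if `A` is Artinian). -/
structure IsFramedDeformation (ρbar : Representation 𝔽 G V) (β : Module.Basis (Fin d) 𝔽 V)
    {A : Type u} [CommRing A] (π : A →+* 𝔽) (r : G →* Matrix (Fin d) (Fin d) A) : Prop where
  continuous : ∀ n : ℕ, IsOpen {g : G | ∀ i j, (r g - 1) i j ∈ RingHom.ker π ^ n}
  reduces : ∀ g : G, (r g).map π = LinearMap.toMatrix β β (ρbar g)

/-- `(R, r)` is the universal framed deformation ring of `(V, ρbar, β)` with its universal framed
deformation: `R` is a complete local Noetherian `W(𝔽)`-algebra with residue field `𝔽`, `r` is a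
framed deformation to `R`, and `(R, r)` pro-represents the functor of framed deformations on the
category of Artinian local `W(𝔽)`-algebras with residue field `𝔽`. -/
structure IsUniversalFramedDeformation (ρbar : Representation 𝔽 G V)
    (β : Module.Basis (Fin d) 𝔽 V) {R : Type u} [CommRing R] [Algebra (WittVector p 𝔽) R] (π : R →+* 𝔽)
    (r : G →* Matrix (Fin d) (Fin d) R) : Prop where
  isLocalWittAlgebra : IsLocalWittAlgebra p π
  isNoetherianRing : IsNoetherianRing R
  isAdicComplete : IsAdicComplete (RingHom.ker π) R
  isFramedDeformation : IsFramedDeformation ρbar β π r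
  universal : ∀ (A : Type u) [CommRing A] [IsArtinianRing A] [Algebra (WittVector p 𝔽) A] (πA : A →+* 𝔽)
    (rA : G →* Matrix (Fin d) (Fin d) A),
    IsLocalWittAlgebra p πA → IsFramedDeformation ρbar β πA rA →
      ∃! φ : R →ₐ[WittVector p 𝔽] A, πA.comp (φ : R →+* A) = π ∧ ∀ g : G, (r g).map φ = rA g

end Deformations

/-! ### Monodromy -/

section Monodromy

/-- The exponential `∑ X ^ k / k!` of a nilpotent matrix `X` over a ring in which the integers `k!`
are invertible. -/
noncomputable def nilExp {A : Type*} [CommRing A] {d : ℕ} (X : Matrix (Fin d) (Fin d) A) :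
    Matrix (Fin d) (Fin d) A :=
  ∑ k ∈ Finset.range (nilpotencyClass X), Ring.inverse (k.factorial : A) • X ^ k

/-- The structure map `ℤ_p = W(𝔽_p) → W(𝔽) → R` of a `W(𝔽)`-algebra `R`. -/
noncomputable def padicToAlg (p : ℕ) [Fact p.Prime] (𝔽 : Type u) [Field 𝔽] [CharP 𝔽 p] (R : Type u)
    [CommRing R] [Algebra (WittVector p 𝔽) R] : ℤ_[p] →+* R :=
  (algebraMap (WittVector p 𝔽) R).comp
    ((WittVector.map (ZMod.castHom (dvd_refl p) 𝔽)).comp (WittVector.fromPadicInt p))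

/-- `N`, a nilpotent matrix over `R[1/p]`, is the monodromy operator of `r : G → GL_d(R)` with
respect to the inertia subgroup `I` of `G` and the `p`-adic tame character `t : I → ℤ_p`: there is
an open subgroup of `I` on which `r σ = exp (t σ • N)`. -/
structure IsMonodromyOperator (p : ℕ) [Fact p.Prime] (𝔽 : Type u) [Field 𝔽] [CharP 𝔽 p]
    {G : Type*} [Group G] [TopologicalSpace G] {I : Subgroup G} (t : I →* Multiplicative ℤ_[p])
    {R : Type u} [CommRing R] [Algebra (WittVector p 𝔽) R] {d : ℕ} (r : G →* Matrix (Fin d) (Fin d) R)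
    (N : Matrix (Fin d) (Fin d) (Localization.Away (p : R))) : Prop where
  isNilpotent : IsNilpotent N
  eq_exp : ∃ U : Subgroup G, IsOpen (U : Set G) ∧ ∀ σ : I, (σ : G) ∈ U →
    (r σ).map (algebraMap R (Localization.Away (p : R))) =
      nilExp (algebraMap R (Localization.Away (p : R))
        (padicToAlg p 𝔽 R (Multiplicative.toAdd (t σ))) • N)

/-- The ideal `J` of `R` cuts out the locus `N = 0`: in `R[1/p]` it generates the same ideal as the
entries of `N`. If `N` has its entries in `R`, the ideal of `R` that they generate is such a `J`;
so is, in all cases, the set of elements of `R` whose image in `R[1/p]` is in the ideal generated by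
the entries of `N`. -/
def CutsOutVanishing (p : ℕ) {R : Type u} [CommRing R] {d : ℕ}
    (N : Matrix (Fin d) (Fin d) (Localization.Away (p : R))) (J : Ideal R) : Prop :=
  J.map (algebraMap R (Localization.Away (p : R))) =
    Ideal.span (Set.range fun ij : Fin d × Fin d => N ij.1 ij.2)

end Monodromy

/-- A complete local Noetherian `W(𝔽)`-algebra `S` with residue field `𝔽` is formally smooth over
`W(𝔽)` of relative dimension `n`: it is isomorphic to `W(𝔽)[[x_1, …, x_n]]`. -/
def IsFormallySmoothOfRelDim (p : ℕ) [Fact p.Prime] (𝔽 : Type u) [Field 𝔽]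
    (S : Type u) [CommRing S] [Algebra (WittVector p 𝔽) S] (n : ℕ) : Prop :=
  Nonempty (S ≃ₐ[WittVector p 𝔽] MvPowerSeries (Fin n) (WittVector p 𝔽))

end FramedDef

/-! Let `H` be the quotient of `I_K` by `I_L`; its order divides `e(L/K)`, so it is a unit in
`W(𝔽)`. The idea is that deformations trivial on `I_L` are unobstructed and are given by one free `d
× d` matrix.

Let `φ` lift Frobenius. The residual representation of `H` lifts to `ρ₀` over `W(𝔽)`
(`exists_rep_lift`), and averaging a lift of `ρbar φ` gives an invertible `Ψ₀` that intertwines `ρ₀`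
with its twist by `φ` (`exists_isStandardPair`). Write `e` for the averaging projector onto the
commutant of `ρ₀`. A framed deformation trivial on `I_L` amounts to a representation `r` of `H` and
a compatible image `F` of `φ`. There is a unique `Y` with `e(Y) = 1` that conjugates `r` to `ρ₀`,
and then `Y F Y⁻¹ = Ψ₀ (1 + C)` with `C` in the commutant. Since `Y - 1` is in the kernel of `e` and
`C` in its image, the pair is encoded without loss or constraint by `Z = (Y - 1) + C`, an arbitrary
matrix over the maximal ideal. Conversely each `Z` over a finite local algebra defines a continuous
representation, because `G_K` is generated topologically by `I_K` and `φ`, with procyclic quotient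
freely generated by `φ` (`IsFrobeniusLift.exists_monoidHom`).

Taking `Z` to be the matrix of variables modulo each truncation and passing to the limit gives `g :
R → W(𝔽)[[x_ij]]` (`exists_algHom_powerSeries`), which is surjective by completeness
(`surjective_algHom_powerSeries`). It remains to see that `J = ker g`. The deformation over `R/J` is
trivial on `I_L`, so each of its finite quotients is obtained by specialising `Z`, and Krull's
intersection theorem gives `ker g ≤ J` (`ker_algHom_powerSeries_le`). In the other direction, the
power series ring is a domain of characteristic zero over which `I_L` acts trivially. Some `σ` in
`I_L`, close to `1`, has `t σ ≠ 0`, and `exp (t σ • N) = 1` forces `N = 0` over the fraction field;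
hence `J ≤ ker g` (`le_ker_of_cutsOutVanishing`). -/

namespace FramedDef

/-! ### Lifting representations of finite groups of invertible order -/

section FiniteGroupLifting

/-- Representations of a finite group of invertible order lift along square-zero extensions. -/
theorem exists_monoidHom_lift_of_sq_zero {H : Type*} [Group H] [Finite H] {E E' : Type*} [Ring E]
    [Ring E'] (φ : E →+* E') (hφ : Function.Surjective φ)
    (hsq : ∀ x y, φ x = 0 → φ y = 0 → x * y = 0) (hH : IsUnit (Nat.card H : E)) (ρ : H →* E') :
    ∃ ρ' : H →* E, ∀ h, φ (ρ' h) = ρ h := by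
  classical
  have := Fintype.ofFinite H
  choose f hf using fun h => hφ (ρ h)
  obtain ⟨c, hc⟩ := hH
  set u : E := ((c⁻¹ : Eˣ) : E) with hu
  have hun : u * (Nat.card H : E) = 1 := by rw [← hc, hu]; simp
  have hcomm : ∀ x : E, x * u = u * x := fun x => by
    have h1 : Commute x (c : E) := by rw [hc]; exact (Nat.cast_commute _ _).symm
    exact (h1.units_inv_right).eq
  -- `δ` is the 2-cocycle obstructing multiplicativity of the set-theoretic lift `f`. The usual
  -- averaging makes `|H| δ` the coboundary of `S`; `f k⁻¹` serves as an inverse of `f k`, which it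
  -- is modulo the square-zero kernel.
  set δ : H → H → E := fun g h => f g * f h - f (g * h) with hδ
  have hδ0 : ∀ g h, φ (δ g h) = 0 := fun g h => by simp [hδ, hf]
  set S : H → E := fun g => ∑ k, δ g k * f k⁻¹ with hS
  have hS0 : ∀ g, φ (S g) = 0 := fun g => by simp [hS, hδ0]
  have key : ∀ g h, f g * S h - S (g * h) + S g * f h = (Nat.card H : E) * δ g h := by
    intro g h
    have e1 : ∀ k, δ g h * (f k * f k⁻¹) = δ g h := fun k => by
      have : δ g h * (f k * f k⁻¹ - 1) = 0 :=
        hsq _ _ (hδ0 g h) (by rw [map_sub, map_mul, hf, hf, ← map_mul, mul_inv_cancel, map_one, map_one, sub_self])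
      rwa [mul_sub, mul_one, sub_eq_zero] at this
    -- After the substitution `k ↦ h k`, the factor `f (h k)⁻¹ * f h` may be replaced by `f k⁻¹`:
    -- the error is a value of `δ`, and products of two such values vanish.
    have e2 : S g * f h = ∑ k, δ g (h * k) * f k⁻¹ := by
      rw [hS, Finset.sum_mul, ← Equiv.sum_comp (Equiv.mulLeft h)]
      refine Finset.sum_congr rfl fun k _ => ?_
      have : δ g (h * k) * δ (h * k)⁻¹ h = 0 := hsq _ _ (hδ0 _ _) (hδ0 _ _)
      have h3 : (h * k)⁻¹ * h = k⁻¹ := by group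
      simp only [hδ, h3, mul_sub, sub_eq_zero] at this
      simp only [Equiv.coe_mulLeft, mul_assoc, hδ]
      exact this
    have e3 : (Nat.card H : E) * δ g h = ∑ k : H, δ g h * (f k * f k⁻¹) := by
      simp [e1]
    rw [e2, e3, hS, Finset.mul_sum, ← Finset.sum_sub_distrib, ← Finset.sum_add_distrib]
    refine Finset.sum_congr rfl fun k _ => ?_
    simp only [hδ, mul_assoc g h k]
    noncomm_ring
  set f' : H → E := fun g => f g - u * S g with hf'
  have hmul : ∀ g h, f' (g * h) = f' g * f' h := by
    intro g h
    have h0 : S g * S h = 0 := hsq _ _ (hS0 g) (hS0 h)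
    have h1 : f g * f h = f (g * h) + δ g h := by simp [hδ]
    have h2 : u * (f g * S h - S (g * h) + S g * f h) = δ g h := by
      rw [key, ← mul_assoc, hun, one_mul]
    have h3 : f' g * f' h = f g * f h - u * (f g * S h) - u * (S g * f h) := by
      simp only [hf', sub_mul, mul_sub]
      have a1 : f g * (u * S h) = u * (f g * S h) := by rw [← mul_assoc, hcomm, mul_assoc]
      have a2 : u * S g * (u * S h) = 0 := by
        rw [mul_assoc, ← mul_assoc (S g), hcomm, mul_assoc, h0]; simp
      rw [a1, a2, mul_assoc]; abel
    rw [h3, h1, ← h2, hf']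
    simp only [mul_add, mul_sub]
    abel
  -- `f' 1` is an idempotent congruent to `1` modulo a square-zero ideal, so `0 = (f' 1 - 1)² = 1 -
  -- f' 1`.
  have hone : f' 1 = 1 := by
    have h1 := hmul 1 1
    have h0 : φ (f' 1 - 1) = 0 := by simp [hf', hf, hS0]
    have h2 := hsq _ _ h0 h0
    rw [one_mul] at h1
    have : (f' 1 - 1) * (f' 1 - 1) = f' 1 * f' 1 - f' 1 - f' 1 + 1 := by noncomm_ring
    rw [this, ← h1] at h2
    rw [sub_self, zero_sub] at h2
    exact (neg_add_eq_zero.mp h2)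
  exact ⟨⟨⟨f', hone⟩, hmul⟩, fun h => by simp [hf', hf, hS0]⟩

variable {Λ : Type*} [CommRing Λ]

/-- Compatible elements of the quotients by powers of `I` come from an `I`-adically complete
ring. -/
theorem exists_mk_eq_of_isAdicComplete (I : Ideal Λ) [IsAdicComplete I Λ]
    (a : ∀ n : ℕ, Λ ⧸ I ^ (n + 1))
    (ha : ∀ n, Ideal.Quotient.factorPow I (Nat.le_succ (n + 1)) (a (n + 1)) = a n) :
    ∃ x : Λ, ∀ n, Ideal.Quotient.mk (I ^ (n + 1)) x = a n := by
  choose y hy using fun n => Ideal.Quotient.mk_surjective (a n)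
  have hstep : ∀ n, y (n + 1) - y n ∈ I ^ (n + 1) := fun n => by
    have h := ha n
    rw [← hy, ← hy] at h
    exact Ideal.Quotient.eq.mp h
  have hcauchy : ∀ m n, m ≤ n → y n - y m ∈ I ^ (m + 1) := by
    intro m n hmn
    induction n, hmn using Nat.le_induction with
    | base => simp
    | succ n hmn ih =>
      have := Ideal.add_mem _ (Ideal.pow_le_pow_right (Nat.succ_le_succ hmn) (hstep n)) ih
      rwa [sub_add_sub_cancel] at this
  obtain ⟨x, hx⟩ := IsPrecomplete.prec (I := I) (M := Λ) inferInstance (f := y) fun {m n} hmn => by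
    rw [SModEq.comm, SModEq.sub_mem, smul_eq_mul, Ideal.mul_top]
    exact Ideal.pow_le_pow_right (Nat.le_succ m) (hcauchy m n hmn)
  refine ⟨x, fun n => ?_⟩
  have h1 := hx (n + 1)
  rw [SModEq.sub_mem, smul_eq_mul, Ideal.mul_top] at h1
  have h2 := Ideal.sub_mem _ (hstep n) h1
  rw [sub_sub_sub_cancel_left] at h2
  rw [← hy, Ideal.Quotient.eq]
  exact h2

theorem matrix_eq_of_forall_mk_eq (I : Ideal Λ) [IsHausdorff I Λ] {d : ℕ}
    {A B : Matrix (Fin d) (Fin d) Λ} (hAB : ∀ n, A.map (Ideal.Quotient.mk (I ^ (n + 1))) =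
        B.map (Ideal.Quotient.mk (I ^ (n + 1)))) : A = B := by
  ext i j
  rw [← sub_eq_zero]
  refine IsHausdorff.haus (I := I) inferInstance _ fun n => ?_
  rw [SModEq.zero, smul_eq_mul, Ideal.mul_top]
  refine Ideal.pow_le_pow_right (Nat.le_succ n) (Ideal.Quotient.eq.mp ?_)
  exact congrFun (congrFun (hAB n) i) j

/-- The limit of a compatible sequence of matrix representations. -/
theorem exists_rep_of_compatible {H : Type*} [Monoid H] {d : ℕ} (I : Ideal Λ) [IsAdicComplete I Λ]
    (ρ : ∀ n : ℕ, H →* Matrix (Fin d) (Fin d) (Λ ⧸ I ^ (n + 1)))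
    (hρ : ∀ n h, (ρ (n + 1) h).map (Ideal.Quotient.factorPow I (Nat.le_succ (n + 1))) = ρ n h) :
    ∃ ρ' : H →* Matrix (Fin d) (Fin d) Λ, ∀ n h,
      (ρ' h).map (Ideal.Quotient.mk (I ^ (n + 1))) = ρ n h := by
  have hlim : ∀ h i j, ∃ x : Λ, ∀ n, Ideal.Quotient.mk (I ^ (n + 1)) x = ρ n h i j :=
    fun h i j => exists_mk_eq_of_isAdicComplete I (fun n => ρ n h i j) fun n =>
      congrFun (congrFun (hρ n h) i) j
  choose M hM using hlim
  have hmk : ∀ n h, (Matrix.of (M h)).map (Ideal.Quotient.mk (I ^ (n + 1))) = ρ n h := by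
    intro n h
    ext i j
    simp [hM]
  refine ⟨⟨⟨fun h => Matrix.of (M h), matrix_eq_of_forall_mk_eq I fun n => ?_⟩,
    fun g h => matrix_eq_of_forall_mk_eq I fun n => ?_⟩, hmk⟩
  · rw [hmk, map_one, Matrix.map_one _ (map_zero _) (map_one _)]
  · rw [Matrix.map_mul, hmk, hmk, hmk, map_mul]

theorem exists_matrix_rep_lift_of_sq_zero {H : Type*} [Group H] [Finite H] {d : ℕ}
    {B B' : Type*} [CommRing B] [CommRing B'] (f : B →+* B') (hf : Function.Surjective f)
    (hsq : ∀ x y, f x = 0 → f y = 0 → x * y = 0) (hH : IsUnit (Nat.card H : B))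
    (ρ : H →* Matrix (Fin d) (Fin d) B') :
    ∃ ρ' : H →* Matrix (Fin d) (Fin d) B, ∀ h, (ρ' h).map f = ρ h := by
  refine exists_monoidHom_lift_of_sq_zero f.mapMatrix (fun M =>
    ⟨M.map (Function.surjInv hf), by ext i j; exact Function.surjInv_eq hf _⟩) ?_ ?_ ρ
  · intro x y hx hy
    ext i j
    rw [Matrix.mul_apply, Matrix.zero_apply]
    exact Finset.sum_eq_zero fun k _ => hsq _ _ (congrFun (congrFun hx i) k)
      (congrFun (congrFun hy k) j)
  · simpa using hH.map (Matrix.scalar (Fin d))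

theorem exists_seq_of_forall_exists {α : ℕ → Type*} (r : ∀ n, α n → α (n + 1) → Prop) (a : α 0)
    (h : ∀ n x, ∃ y, r n x y) : ∃ f : ∀ n, α n, f 0 = a ∧ ∀ n, r n (f n) (f (n + 1)) := by
  choose g hg using h
  exact ⟨fun n => Nat.rec a g n, rfl, fun n => hg n _⟩

/-- The kernel `I^(n+1) / I^(n+2)` has square zero because `2(n+1) ≥ n+2`; this is why the tower
starts at exponent `1`. -/
theorem exists_rep_lift_quotient_pow {H : Type*} [Group H] [Finite H] {d : ℕ} (I : Ideal Λ)
    (hH : IsUnit (Nat.card H : Λ)) (n : ℕ) (ρ : H →* Matrix (Fin d) (Fin d) (Λ ⧸ I ^ (n + 1))) :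
    ∃ ρ' : H →* Matrix (Fin d) (Fin d) (Λ ⧸ I ^ (n + 1 + 1)),
      ∀ h, (ρ' h).map (Ideal.Quotient.factorPow I (Nat.le_succ (n + 1))) = ρ h := by
  refine exists_matrix_rep_lift_of_sq_zero _ (Ideal.Quotient.factor_surjective _) ?_
    (by simpa using hH.map (Ideal.Quotient.mk (I ^ (n + 1 + 1)))) ρ
  intro x y hx hy
  obtain ⟨x, rfl⟩ := Ideal.Quotient.mk_surjective x
  obtain ⟨y, rfl⟩ := Ideal.Quotient.mk_surjective y
  have hx := Ideal.Quotient.eq_zero_iff_mem.mp hx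
  have hy := Ideal.Quotient.eq_zero_iff_mem.mp hy
  rw [← map_mul, Ideal.Quotient.eq_zero_iff_mem]
  have := Ideal.mul_mem_mul hx hy
  rw [← pow_add] at this
  exact Ideal.pow_le_pow_right (by omega) this

/-- Bottom of the tower: `Λ ⧸ I → F` is an isomorphism, so it is treated as a square-zero extension
with zero kernel. The conclusion is phrased through matrices over `Λ` so that it applies directly to
the limit. -/
theorem exists_rep_lift_quotient {H : Type*} [Group H] [Finite H] {d : ℕ} {F : Type*} [CommRing F]
    (ε : Λ →+* F) (hε : Function.Surjective ε) (I : Ideal Λ) (hI : I = RingHom.ker ε)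
    (hH : IsUnit (Nat.card H : Λ)) (ρ : H →* Matrix (Fin d) (Fin d) F) :
    ∃ ρ' : H →* Matrix (Fin d) (Fin d) (Λ ⧸ I), ∀ (h) (M : Matrix (Fin d) (Fin d) Λ),
      M.map (Ideal.Quotient.mk I) = ρ' h → M.map ε = ρ h := by
  obtain ⟨ρ1, hρ1⟩ := exists_matrix_rep_lift_of_sq_zero
    (Ideal.Quotient.lift I ε fun a ha => RingHom.mem_ker.mp (hI ▸ ha))
    (Ideal.Quotient.lift_surjective_of_surjective _ _ hε) (fun x y hx _ => by
      obtain ⟨x, rfl⟩ := Ideal.Quotient.mk_surjective x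
      rw [Ideal.Quotient.lift_mk, ← RingHom.mem_ker, ← hI, ← Ideal.Quotient.eq_zero_iff_mem] at hx
      rw [hx, zero_mul])
    (by simpa using hH.map (Ideal.Quotient.mk I)) ρ
  refine ⟨ρ1, fun h M hM => ?_⟩
  rw [← hρ1, ← hM]
  ext i j
  simp

/-- Representations of a finite group of invertible order lift to complete rings. -/
theorem exists_rep_lift {H : Type*} [Group H] [Finite H] {d : ℕ} {F : Type*} [CommRing F]
    (ε : Λ →+* F) (hε : Function.Surjective ε) [IsAdicComplete (RingHom.ker ε) Λ]
    (hH : IsUnit (Nat.card H : Λ)) (ρ : H →* Matrix (Fin d) (Fin d) F) :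
    ∃ ρ' : H →* Matrix (Fin d) (Fin d) Λ, ∀ h, (ρ' h).map ε = ρ h := by
  generalize hI : RingHom.ker ε = I at *
  obtain ⟨ρ1, hρ1⟩ := exists_rep_lift_quotient ε hε (I ^ (0 + 1)) (by rw [hI, zero_add, pow_one])
    hH ρ
  obtain ⟨seq, hseq0, hseq⟩ := exists_seq_of_forall_exists
    (α := fun n => H →* Matrix (Fin d) (Fin d) (Λ ⧸ I ^ (n + 1))) _ ρ1
    (exists_rep_lift_quotient_pow I hH)
  obtain ⟨ρ', hρ'⟩ := exists_rep_of_compatible I seq hseq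
  exact ⟨ρ', fun h => hρ1 h _ (by rw [hρ', hseq0])⟩

end FiniteGroupLifting

/-! ### The averaging projector and the encoding of pairs `(r, F)` by one matrix -/

section Averaging

variable {H : Type*} [Group H] {E E' : Type*} [Ring E] [Ring E']

/-- The average of the conjugates `ρ h * Z * (σ h)⁻¹` of `Z` over a finite group. -/
noncomputable def groupAverage (ρ σ : H →* E) (Z : E) : E :=
  Ring.inverse (Nat.card H : E) * ∑ᶠ h, ρ h * Z * σ h⁻¹

theorem groupAverage_eq [Fintype H] (ρ σ : H →* E) (Z : E) :
    groupAverage ρ σ Z = Ring.inverse (Nat.card H : E) * ∑ h, ρ h * Z * σ h⁻¹ := by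
  rw [groupAverage, finsum_eq_sum_of_fintype]

/-- The conjugating matrix with parameter `Z`. -/
noncomputable def conjParam (ρ₀ : H →* E) (Z : E) : E := 1 + Z - groupAverage ρ₀ ρ₀ Z

/-- The normalised image of the Frobenius element with parameter `Z`. -/
noncomputable def frobParam (ρ₀ : H →* E) (Ψ₀ Z : E) : E := Ψ₀ * (1 + groupAverage ρ₀ ρ₀ Z)

/-- The pair of the representation `r` of `H` and of `F` has parameter `Z`. -/
structure HasParam (ρ₀ : H →* E) (Ψ₀ Z : E) (r : H →* E) (F : E) : Prop where
  conj_mul : ∀ h, conjParam ρ₀ Z * r h = ρ₀ h * conjParam ρ₀ Z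
  conj_mul_frob : conjParam ρ₀ Z * F = frobParam ρ₀ Ψ₀ Z * conjParam ρ₀ Z

theorem HasParam.eq_rep {ρ₀ : H →* E} {Ψ₀ Z : E} {r r' : H →* E} {F F' : E} (h : HasParam ρ₀ Ψ₀ Z r F) (h' : HasParam ρ₀ Ψ₀ Z r' F')
    (hu : IsUnit (conjParam ρ₀ Z)) : r = r' ∧ F = F' :=
  ⟨MonoidHom.ext fun x => hu.mul_left_cancel (by rw [h.conj_mul, h'.conj_mul]),
    hu.mul_left_cancel (by rw [h.conj_mul_frob, h'.conj_mul_frob])⟩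

variable [Finite H]

theorem commute_inverse_natCast (n : ℕ) (x : E) : Commute x (Ring.inverse (n : E)) := by
  by_cases h : IsUnit (n : E)
  · obtain ⟨c, hc⟩ := h
    rw [← hc, Ring.inverse_unit]
    have : Commute x (c : E) := by rw [hc]; exact (Nat.cast_commute _ _).symm
    exact this.units_inv_right
  · rw [Ring.inverse_non_unit _ h]
    exact Commute.zero_right x

theorem groupAverage_add (ρ σ : H →* E) (Z Z' : E) :
    groupAverage ρ σ (Z + Z') = groupAverage ρ σ Z + groupAverage ρ σ Z' := by
  have := Fintype.ofFinite H
  simp [groupAverage_eq, mul_add, add_mul, Finset.sum_add_distrib]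

theorem groupAverage_sub (ρ σ : H →* E) (Z Z' : E) :
    groupAverage ρ σ (Z - Z') = groupAverage ρ σ Z - groupAverage ρ σ Z' := by
  have := Fintype.ofFinite H
  simp [groupAverage_eq, mul_sub, sub_mul, Finset.sum_sub_distrib]

@[simp]
theorem groupAverage_zero (ρ σ : H →* E) : groupAverage ρ σ 0 = 0 := by
  have := Fintype.ofFinite H
  simp [groupAverage_eq]

theorem mul_groupAverage {ρ ρ' : H →* E} (σ : H →* E) {M : E} (hM : ∀ h, M * ρ h = ρ' h * M)
    (Z : E) : M * groupAverage ρ σ Z = groupAverage ρ' σ (M * Z) := by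
  have := Fintype.ofFinite H
  rw [groupAverage_eq, groupAverage_eq, ← mul_assoc, (commute_inverse_natCast _ M).eq, mul_assoc,
    Finset.mul_sum]
  simp only [← mul_assoc, hM]

theorem mul_groupAverage_self (ρ σ : H →* E) (Z : E) (g : H) :
    ρ g * groupAverage ρ σ Z = groupAverage ρ σ Z * σ g := by
  have := Fintype.ofFinite H
  rw [groupAverage_eq, ← mul_assoc, (commute_inverse_natCast _ (ρ g)).eq, mul_assoc, mul_assoc,
    Finset.mul_sum, Finset.sum_mul, ← Equiv.sum_comp (Equiv.mulLeft g⁻¹)]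
  congr 1
  refine Finset.sum_congr rfl fun h _ => ?_
  simp only [Equiv.coe_mulLeft, map_mul, mul_inv_rev, inv_inv, ← mul_assoc]
  rw [← map_mul, mul_inv_cancel, map_one, one_mul]

theorem groupAverage_of_intertwines (hH : IsUnit (Nat.card H : E)) {ρ σ : H →* E} {Z : E}
    (hZ : ∀ h, ρ h * Z = Z * σ h) : groupAverage ρ σ Z = Z := by
  have := Fintype.ofFinite H
  rw [groupAverage_eq]
  simp only [hZ, mul_assoc, ← map_mul, mul_inv_cancel, map_one, mul_one, Finset.sum_const,
    nsmul_eq_mul, Finset.card_univ, ← Nat.card_eq_fintype_card]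
  rw [← mul_assoc, Ring.inverse_mul_cancel _ hH, one_mul]

theorem groupAverage_idem (hH : IsUnit (Nat.card H : E)) (ρ σ : H →* E) (Z : E) :
    groupAverage ρ σ (groupAverage ρ σ Z) = groupAverage ρ σ Z :=
  groupAverage_of_intertwines hH (mul_groupAverage_self ρ σ Z)

theorem map_ringInverse (f : E →+* E') {x : E} (hx : IsUnit x) :
    f (Ring.inverse x) = Ring.inverse (f x) := by
  obtain ⟨c, rfl⟩ := hx
  rw [Ring.inverse_unit]
  exact (Ring.inverse_unit (Units.map (f : E →* E') c)).symm

theorem map_groupAverage (f : E →+* E') (hH : IsUnit (Nat.card H : E)) (ρ σ : H →* E) (Z : E) :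
    f (groupAverage ρ σ Z) =
      groupAverage ((f : E →* E').comp ρ) ((f : E →* E').comp σ) (f Z) := by
  have := Fintype.ofFinite H
  rw [groupAverage_eq, groupAverage_eq, map_mul, map_ringInverse f hH]
  simp

theorem map_conjParam (f : E →+* E') (hH : IsUnit (Nat.card H : E)) (ρ₀ : H →* E) (Z : E) :
    f (conjParam ρ₀ Z) = conjParam ((f : E →* E').comp ρ₀) (f Z) := by
  simp [conjParam, map_groupAverage f hH]

theorem map_frobParam (f : E →+* E') (hH : IsUnit (Nat.card H : E)) (ρ₀ : H →* E) (Ψ₀ Z : E) :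
    f (frobParam ρ₀ Ψ₀ Z) = frobParam ((f : E →* E').comp ρ₀) (f Ψ₀) (f Z) := by
  simp [frobParam, map_groupAverage f hH]

@[simp]
theorem conjParam_zero (ρ₀ : H →* E) : conjParam ρ₀ 0 = 1 := by simp [conjParam]

@[simp]
theorem frobParam_zero (ρ₀ : H →* E) (Ψ₀ : E) : frobParam ρ₀ Ψ₀ 0 = Ψ₀ := by simp [frobParam]

/-- Averaging is an idempotent fixing `1`, so it kills `Z - e(Z)`. This normalisation is what makes
the conjugating matrix unique. -/
theorem groupAverage_conjParam (hH : IsUnit (Nat.card H : E)) (ρ₀ : H →* E) (Z : E) :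
    groupAverage ρ₀ ρ₀ (conjParam ρ₀ Z) = 1 := by
  rw [conjParam, groupAverage_sub, groupAverage_add, groupAverage_idem hH,
    groupAverage_of_intertwines hH (Z := 1) (by simp)]
  abel

namespace HasParam

variable {ρ₀ : H →* E} {Ψ₀ Z Z' : E} {r r' : H →* E} {F F' : E}

theorem zero (ρ₀ : H →* E) (Ψ₀ : E) : HasParam ρ₀ Ψ₀ 0 ρ₀ Ψ₀ := ⟨by simp, by simp⟩

theorem map (h : HasParam ρ₀ Ψ₀ Z r F) (f : E →+* E') (hH : IsUnit (Nat.card H : E)) :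
    HasParam ((f : E →* E').comp ρ₀) (f Ψ₀) (f Z) ((f : E →* E').comp r) (f F) where
  conj_mul x := by
    rw [← map_conjParam f hH]
    simpa using congrArg f (h.conj_mul x)
  conj_mul_frob := by
    rw [← map_conjParam f hH, ← map_frobParam f hH, ← map_mul, ← map_mul, h.conj_mul_frob]

/-- The parameter is determined by the pair. -/
theorem eq_param (h : HasParam ρ₀ Ψ₀ Z r F) (h' : HasParam ρ₀ Ψ₀ Z' r F)
    (hH : IsUnit (Nat.card H : E)) (hΨ : IsUnit Ψ₀) (hu : IsUnit (conjParam ρ₀ Z)) :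
    Z = Z' := by
  -- The conjugator is inverse to a matrix that depends on `r` alone. Once it is known, `F`
  -- determines `Ψ₀ (1 + e(Z))`, hence `e(Z)`, and then `Z` itself.
  have key : ∀ {Z : E}, HasParam ρ₀ Ψ₀ Z r F → conjParam ρ₀ Z * groupAverage r ρ₀ 1 = 1 := by
    intro Z h
    rw [mul_groupAverage ρ₀ h.conj_mul, mul_one, groupAverage_conjParam hH]
  have hY : conjParam ρ₀ Z = conjParam ρ₀ Z' := by
    have hX : IsUnit (groupAverage r ρ₀ 1) := by
      obtain ⟨y, hy⟩ := hu
      have := key h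
      rw [← hy, Units.mul_eq_one_iff_inv_eq] at this
      exact this ▸ Units.isUnit _
    exact hX.mul_right_cancel (by rw [key h, key h'])
  have hf : frobParam ρ₀ Ψ₀ Z = frobParam ρ₀ Ψ₀ Z' :=
    hu.mul_right_cancel (by rw [← h.conj_mul_frob, hY, ← h'.conj_mul_frob])
  have he : groupAverage ρ₀ ρ₀ Z = groupAverage ρ₀ ρ₀ Z' :=
    add_left_cancel (hΨ.mul_left_cancel hf)
  rw [conjParam, conjParam, he] at hY
  exact add_left_cancel (sub_left_injective hY)

end HasParam

/-- A pair whose averaged intertwiner is invertible has a parameter, which vanishes modulo every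
ideal modulo which the pair is the standard one. -/
theorem exists_hasParam {ρ₀ : H →* E} {Ψ₀ : E} {θ : H →* H} (hH : IsUnit (Nat.card H : E))
    (hΨ : IsUnit Ψ₀) (hθ : ∀ h, Ψ₀ * ρ₀ h = ρ₀ (θ h) * Ψ₀) {r : H →* E} {F : E}
    (hF : ∀ h, F * r h = r (θ h) * F) (hX : IsUnit (groupAverage r ρ₀ 1)) (f : E →+* E')
    (hr : ∀ h, f (r h) = f (ρ₀ h)) (hf : f F = f Ψ₀) :
    ∃ Z, f Z = 0 ∧ HasParam ρ₀ Ψ₀ Z r F := by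
  obtain ⟨X, hX⟩ := hX
  obtain ⟨P, rfl⟩ := hΨ
  have hXr : ∀ h, r h * X = X * ρ₀ h := fun h => by rw [hX]; exact mul_groupAverage_self r ρ₀ 1 h
  set Y : E := ((X⁻¹ : Eˣ) : E) with hYdef
  have hYX : Y * X = 1 := X.inv_mul
  have hXY : (X : E) * Y = 1 := X.mul_inv
  have hYr : ∀ h, Y * r h = ρ₀ h * Y := fun h => by
    calc Y * r h = Y * (r h * X) * Y := by rw [mul_assoc, mul_assoc, hXY, mul_one]
      _ = ρ₀ h * Y := by rw [hXr, ← mul_assoc, hYX, one_mul]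
  have heY : groupAverage ρ₀ ρ₀ Y = 1 := by
    rw [← hYX, hX, mul_groupAverage ρ₀ hYr, mul_one]
  set Q : E := ((P⁻¹ : Eˣ) : E) with hQdef
  have hQP : Q * P = 1 := P.inv_mul
  have hPQ : (P : E) * Q = 1 := P.mul_inv
  have hQ : ∀ h, ρ₀ h * Q = Q * ρ₀ (θ h) := fun h => by
    calc ρ₀ h * Q = Q * (P * ρ₀ h) * Q := by rw [← mul_assoc Q, hQP, one_mul]
      _ = Q * ρ₀ (θ h) := by rw [hθ, mul_assoc, mul_assoc, hPQ, mul_one]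
  -- `Y F X` and `Ψ₀` both intertwine `ρ₀` with `ρ₀ ∘ θ`, so their quotient, and with it `C`,
  -- commutes with `ρ₀`.
  set C : E := Q * (Y * F * X) - 1 with hCdef
  have hC : ∀ h, ρ₀ h * C = C * ρ₀ h := fun h => by
    have h1 : Y * F * X * ρ₀ h = ρ₀ (θ h) * (Y * F * X) := by
      calc Y * F * X * ρ₀ h = Y * (F * r h) * X := by rw [mul_assoc, ← hXr]; noncomm_ring
        _ = Y * r (θ h) * F * X := by rw [hF]; noncomm_ring
        _ = ρ₀ (θ h) * (Y * F * X) := by rw [hYr]; noncomm_ring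
    rw [hCdef, mul_sub, sub_mul, mul_one, one_mul, ← mul_assoc, hQ, mul_assoc, ← h1]
    noncomm_ring
  have heC : groupAverage ρ₀ ρ₀ C = C := groupAverage_of_intertwines hH hC
  have he1 : groupAverage ρ₀ ρ₀ (1 : E) = 1 := groupAverage_of_intertwines hH (by simp)
  -- The projector kills `Y - 1` and fixes `C`, so both summands can be recovered from their sum.
  have heZ : groupAverage ρ₀ ρ₀ (Y - 1 + C) = C := by
    rw [groupAverage_add, groupAverage_sub, heC, heY, he1, sub_self, zero_add]
  have hconj : conjParam ρ₀ (Y - 1 + C) = Y := by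
    rw [conjParam, heZ]; abel
  have hfrob : frobParam ρ₀ (P : E) (Y - 1 + C) = Y * F * X := by
    rw [frobParam, heZ, hCdef, add_sub_cancel, ← mul_assoc, hPQ, one_mul]
  refine ⟨Y - 1 + C, ?_, ⟨?_, ?_⟩⟩
  · have hfX : f X = 1 := by
      rw [hX, map_groupAverage f hH, map_one]
      refine groupAverage_of_intertwines (by simpa using hH.map f) fun h => ?_
      simp [hr]
    have hfY : f Y = 1 := by simpa [hfX] using congrArg f hYX
    have hfQ : f Q * f P = 1 := by rw [← map_mul, hQP, map_one]
    simp [hCdef, hfX, hfY, hf, hfQ]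
  · intro h; rw [hconj, hYr]
  · rw [hconj, hfrob, mul_assoc, hXY, mul_one]

end Averaging

/-! ### Homomorphisms out of an extension of a procyclic group -/

section ProcyclicQuotient

variable {G : Type*} [Group G] [TopologicalSpace G]

/-- `I` is a normal subgroup of `G` such that `G ⧸ I` is topologically generated by the free element
`φ`, and `I'` is a normal subgroup contained in `I` that is the trace on `I` of an open subgroup. -/
structure IsFrobeniusLift (I I' : Subgroup G) (φ : G) : Prop where
  normal : I.Normal
  normal' : I'.Normal
  le : I' ≤ I
  dense : ∀ U : Subgroup G, IsOpen (U : Set G) → ∀ g, ∃ i ∈ I, ∃ k : ℤ, ∃ u ∈ U, g = i * φ ^ k * u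
  separated : ∀ n : ℕ, n ≠ 0 → ∃ U : Subgroup G, U.Normal ∧ IsOpen (U : Set G) ∧
    ∀ i ∈ I, ∀ k : ℤ, i * φ ^ k ∈ U → (n : ℤ) ∣ k ∧ i ∈ I'

namespace IsFrobeniusLift

variable {I I' : Subgroup G} {φ : G}

theorem monoidHom_eq (hφ : IsFrobeniusLift I I' φ) {M : Type*} [Monoid M] {f f' : G →* M}
    {U U' : Subgroup G} (hU : IsOpen (U : Set G)) (hU' : IsOpen (U' : Set G))
    (hf : ∀ u ∈ U, f u = 1) (hf' : ∀ u ∈ U', f' u = 1) (hI : ∀ i ∈ I, f i = f' i)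
    (hfφ : f φ = f' φ) : f = f' := by
  ext g
  obtain ⟨i, hi, k, u, hu, rfl⟩ := hφ.dense (U ⊓ U') (by simpa using hU.inter hU') g
  rw [map_mul, map_mul, map_mul, map_mul, hI i hi, hf u hu.1, hf' u hu.2]
  have h : φ ^ k ∈ f.eqLocus f' := zpow_mem (show φ ∈ f.eqLocus f' from hfφ) k
  rw [show f (φ ^ k) = f' (φ ^ k) from h]

/-- A homomorphism to a finite group is determined by compatible values on `I` and on `φ`. -/
theorem exists_monoidHom (hφ : IsFrobeniusLift I I' φ) [I.Normal] {Γ : Type*} [Group Γ] [Finite Γ]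
    (α : I →* Γ) (hα : ∀ i : I, (i : G) ∈ I' → α i = 1) (γ : Γ)
    (hγ : ∀ i : I, γ * α i * γ⁻¹ = α (MulAut.conjNormal φ i)) :
    ∃ f : G →* Γ, (∀ i : I, f i = α i) ∧ f φ = γ ∧
      ∃ U : Subgroup G, IsOpen (U : Set G) ∧ ∀ u ∈ U, f u = 1 := by
  have hγk : ∀ (k : ℤ) (i : I), γ ^ k * α i * (γ ^ k)⁻¹ = α (MulAut.conjNormal (φ ^ k) i) := by
    have hinv : ∀ i : I, γ⁻¹ * α i * γ = α (MulAut.conjNormal φ⁻¹ i) := fun i => by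
      have h := hγ (MulAut.conjNormal φ⁻¹ i)
      rw [← MulAut.mul_apply, ← map_mul, mul_inv_cancel, map_one, MulAut.one_apply] at h
      rw [← h]; group
    intro k
    induction k with
    | zero => intro i; simp
    | succ k ih =>
      intro i
      rw [zpow_add_one φ, map_mul, MulAut.mul_apply, ← ih, ← hγ, zpow_add_one]; group
    | pred k ih =>
      intro i
      rw [zpow_sub_one φ, map_mul, MulAut.mul_apply, ← ih, ← hinv, zpow_sub_one]; group
  -- With this `U`, if `i φ^k` is in `U` then `γ^k = 1` and `α i = 1`. So `α i * γ^k` depends only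
  -- on the element `i φ^k u`, not on how it is decomposed.
  obtain ⟨U, hUn, hUo, hU⟩ := hφ.separated (orderOf γ) (orderOf_pos γ).ne'
  have hwd : ∀ (i i' : I) (k k' : ℤ) (u u' : G), u ∈ U → u' ∈ U →
      (i : G) * φ ^ k * u = i' * φ ^ k' * u' → α i * γ ^ k = α i' * γ ^ k' := by
    intro i i' k k' u u' hu hu' h
    have h1 : ((i'⁻¹ * i : I) : G) * φ ^ (k - k') ∈ U := by
      have h2 := hUn.conj_mem _ (mul_mem hu' (inv_mem hu)) (φ ^ k')
      convert h2 using 1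
      have h3 : u' = (i' * φ ^ k')⁻¹ * (i * φ ^ k * u) := by rw [h]; group
      rw [h3, zpow_sub]
      push_cast
      group
    obtain ⟨⟨m, hm⟩, h3⟩ := hU _ (i'⁻¹ * i).2 _ h1
    have h4 := hα _ h3
    rw [map_mul, map_inv, inv_mul_eq_one] at h4
    have h5 : γ ^ (k - k') = 1 := by rw [hm, zpow_mul, zpow_natCast, pow_orderOf_eq_one, one_zpow]
    rw [zpow_sub, mul_inv_eq_one] at h5
    rw [h4, h5]
  -- The value is characterised over all decompositions, so any convenient one can be used to
  -- compute it.
  have hex : ∀ g : G, ∃ x : Γ, ∀ (i : I) (k : ℤ) (u : G), u ∈ U → g = i * φ ^ k * u →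
      x = α i * γ ^ k := by
    intro g
    obtain ⟨i, hi, k, u, hu, rfl⟩ := hφ.dense U hUo g
    exact ⟨α ⟨i, hi⟩ * γ ^ k, fun i' k' u' hu' h => hwd ⟨i, hi⟩ i' k k' u u' hu hu' h⟩
  choose f hf using hex
  have hmul : ∀ g g', f (g * g') = f g * f g' := by
    intro g g'
    obtain ⟨i, hi, k, u, hu, rfl⟩ := hφ.dense U hUo g
    obtain ⟨i', hi', k', u', hu', rfl⟩ := hφ.dense U hUo g'
    rw [hf _ ⟨i, hi⟩ k u hu rfl, hf _ ⟨i', hi'⟩ k' u' hu' rfl,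
      hf _ (⟨i, hi⟩ * MulAut.conjNormal (φ ^ k) ⟨i', hi'⟩) (k + k')
        ((i' * φ ^ k')⁻¹ * u * (i' * φ ^ k') * u')
        (mul_mem (by simpa using hUn.conj_mem u hu (i' * φ ^ k')⁻¹) hu') ?_]
    · rw [map_mul, ← hγk, zpow_add]; group
    · push_cast
      rw [MulAut.conjNormal_apply, zpow_add]
      group
  refine ⟨MonoidHom.mk' f hmul, fun i => ?_, ?_, U, hUo, fun u hu => ?_⟩
  · simpa using hf i i 0 1 (one_mem _) (by simp)
  · simpa using hf φ 1 1 1 (one_mem _) (by simp)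
  · simpa using hf u 1 0 u hu (by simp)

end IsFrobeniusLift

end ProcyclicQuotient

/-! ### Truncations and evaluation of power series -/

section PowerSeries

open MvPowerSeries

variable {σ : Type*} {Λ : Type*} [CommRing Λ]

/-- The power series whose coefficients in degrees less than `n` are in `I ^ n`. -/
def truncIdeal (σ : Type*) (I : Ideal Λ) (n : ℕ) : Ideal (MvPowerSeries σ Λ) where
  carrier := {f | ∀ m : σ →₀ ℕ, m.degree < n → coeff m f ∈ I ^ n}
  zero_mem' m _ := by simp
  add_mem' hf hg m hm := by
    rw [map_add]
    exact Ideal.add_mem _ (hf m hm) (hg m hm)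
  smul_mem' c f hf m hm := by
    classical
    rw [smul_eq_mul, coeff_mul]
    refine Ideal.sum_mem _ fun ab hab => Ideal.mul_mem_left _ _ (hf _ ?_)
    have h := congrArg Finsupp.degree (Finset.HasAntidiagonal.mem_antidiagonal.mp hab)
    rw [map_add] at h
    omega

theorem truncIdeal_antitone (I : Ideal Λ) : Antitone (truncIdeal σ I) := fun _ _ hkn _ hf m hm =>
  Ideal.pow_le_pow_right hkn (hf m (hm.trans_le hkn))

/-- A class is determined by its finitely many coefficients of degree below `n`, each modulo `I ^
n`. Finiteness makes the truncations admissible Artinian test rings, whose matrix units form a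
finite group. -/
theorem finite_quotient_truncIdeal [Finite σ] {I : Ideal Λ} (hI : I.FG) [Finite (Λ ⧸ I)] (n : ℕ) :
    Finite (MvPowerSeries σ Λ ⧸ truncIdeal σ I n) := by
  have := Ideal.finite_quotient_pow hI n
  have : Finite {m : σ →₀ ℕ // m.degree ≤ n} := Finsupp.finite_of_degree_le n
  -- Exponents of degree exactly `n` carry the dummy value `0`; they are included only to have an
  -- index set known to be finite.
  refine Finite.of_injective (β := {m : σ →₀ ℕ // m.degree ≤ n} → Λ ⧸ I ^ n)
    (fun x m => Ideal.Quotient.mk _ (if m.1.degree < n then coeff m.1 (Quotient.out x) else 0)) ?_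
  intro x y hxy
  rw [← Ideal.Quotient.mk_out x, ← Ideal.Quotient.mk_out y, Ideal.Quotient.eq]
  intro m hm
  have h := congrFun hxy ⟨m, hm.le⟩
  rw [map_sub]
  simpa [hm] using Ideal.Quotient.eq.mp h

theorem eq_zero_of_forall_mem_truncIdeal {I : Ideal Λ} [IsHausdorff I Λ] {f : MvPowerSeries σ Λ}
    (hf : ∀ n, f ∈ truncIdeal σ I n) : f = 0 := by
  ext m
  refine IsHausdorff.haus (I := I) inferInstance _ fun n => ?_
  rw [SModEq.zero, smul_eq_mul, Ideal.mul_top]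
  exact Ideal.pow_le_pow_right (by omega) (hf (n + m.degree + 1) m (by omega))

theorem exists_mk_truncIdeal_eq {I : Ideal Λ} [IsAdicComplete I Λ]
    (a : ∀ n, MvPowerSeries σ Λ ⧸ truncIdeal σ I n)
    (ha : ∀ n, Ideal.Quotient.factor (truncIdeal_antitone I n.le_succ) (a (n + 1)) = a n) :
    ∃ f, ∀ n, Ideal.Quotient.mk (truncIdeal σ I n) f = a n := by
  choose y hy using fun n => Ideal.Quotient.mk_surjective (a n)
  have hstep : ∀ n, y (n + 1) - y n ∈ truncIdeal σ I n := fun n => by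
    have h := ha n
    rw [← hy, ← hy] at h
    exact Ideal.Quotient.eq.mp h
  have hcauchy : ∀ m n, m ≤ n → y n - y m ∈ truncIdeal σ I m := by
    intro m n hmn
    induction n, hmn using Nat.le_induction with
    | base => simp
    | succ n hmn ih =>
      have := Ideal.add_mem _ (truncIdeal_antitone I hmn (hstep n)) ih
      rwa [sub_add_sub_cancel] at this
  -- Truncation number `k` controls the coefficient at `m` only if `m.degree < k`, hence the shift
  -- of the index by `m.degree + 1`.
  have hlim : ∀ m : σ →₀ ℕ, ∃ x : Λ, ∀ n, coeff m (y (n + m.degree + 1)) - x ∈ I ^ n := by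
    intro m
    obtain ⟨x, hx⟩ := IsPrecomplete.prec (I := I) (M := Λ) inferInstance
      (f := fun n => coeff m (y (n + m.degree + 1))) fun {k n} hkn => by
        rw [SModEq.comm, SModEq.sub_mem, smul_eq_mul, Ideal.mul_top, ← map_sub]
        exact Ideal.pow_le_pow_right (by omega)
          (hcauchy (k + m.degree + 1) (n + m.degree + 1) (by omega) m (by omega))
    refine ⟨x, fun n => ?_⟩
    have h1 := hx n
    rwa [SModEq.sub_mem, smul_eq_mul, Ideal.mul_top] at h1
  choose c hc using hlim
  obtain ⟨f, hf⟩ : ∃ f : MvPowerSeries σ Λ, ∀ m, coeff m f = c m := ⟨fun m => c m, fun m => rfl⟩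
  refine ⟨f, fun n => ?_⟩
  rw [← hy, Ideal.Quotient.eq]
  intro m hm
  have h1 := hcauchy n (n + m.degree + 1) (by omega) m hm
  have h2 := Ideal.sub_mem _ h1 (hc m n)
  rw [map_sub, sub_sub_sub_cancel_left] at h2
  rw [map_sub, hf]
  exact h2

/-- Compatible homomorphisms to the truncations of a power series ring come from a homomorphism
to the power series ring. -/
theorem exists_algHom_mk_truncIdeal_eq {I : Ideal Λ} [IsAdicComplete I Λ] {R : Type*} [CommRing R]
    [Algebra Λ R] (g : ∀ n, R →ₐ[Λ] MvPowerSeries σ Λ ⧸ truncIdeal σ I n)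
    (hg : ∀ n s, Ideal.Quotient.factor (truncIdeal_antitone I n.le_succ) (g (n + 1) s) = g n s) :
    ∃ f : R →ₐ[Λ] MvPowerSeries σ Λ, ∀ n s, Ideal.Quotient.mk (truncIdeal σ I n) (f s) = g n s := by
  choose f hf using fun s => exists_mk_truncIdeal_eq (fun n => g n s) fun n => hg n s
  have hext : ∀ x y : MvPowerSeries σ Λ, (∀ n, Ideal.Quotient.mk (truncIdeal σ I n) x =
      Ideal.Quotient.mk (truncIdeal σ I n) y) → x = y := fun x y h =>
    sub_eq_zero.mp (eq_zero_of_forall_mem_truncIdeal fun n => Ideal.Quotient.eq.mp (h n))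
  refine ⟨⟨⟨⟨⟨f, hext _ _ fun n => ?_⟩, fun x y => hext _ _ fun n => ?_⟩, hext _ _ fun n => ?_,
    fun x y => hext _ _ fun n => ?_⟩, fun c => hext _ _ fun n => ?_⟩, fun n s => hf s n⟩
  · simp [hf]
  · simp [hf]
  · change _ = Ideal.Quotient.mk _ 0
    simp [hf]
  · change _ = Ideal.Quotient.mk _ (f x + f y)
    simp [hf]
  · change Ideal.Quotient.mk _ (f _) = _
    rw [hf, AlgHom.commutes]
    rfl

/-- Each nonconstant monomial is charged to one chosen variable `c m` occurring in it; `q s`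
collects the terms charged to `s`, divided by `X s`. Finiteness of `σ` makes `∑ X s * q s` a finite
sum. -/
theorem mem_span_X_of_constantCoeff_eq_zero [Finite σ] {f : MvPowerSeries σ Λ}
    (hf : constantCoeff f = 0) :
    f ∈ Ideal.span (Set.range (X : σ → MvPowerSeries σ Λ)) := by
  classical
  have := Fintype.ofFinite σ
  rcases isEmpty_or_nonempty σ with hσ | hσ
  · have : f = 0 := by
      ext m
      rw [Subsingleton.elim m 0]
      simpa using hf
    rw [this]
    exact Ideal.zero_mem _
  have hex : ∀ m : σ →₀ ℕ, m ≠ 0 → ∃ s, m s ≠ 0 := fun m hm => Finsupp.ne_iff.mp hm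
  choose! c hc using hex
  obtain ⟨q, hq⟩ : ∃ q : σ → MvPowerSeries σ Λ, ∀ s m, coeff m (q s) =
      if c (m + Finsupp.single s 1) = s then coeff (m + Finsupp.single s 1) f else 0 :=
    ⟨fun s m => if c (m + Finsupp.single s 1) = s then coeff (m + Finsupp.single s 1) f else 0,
      fun _ _ => rfl⟩
  have hfsum : f = ∑ s, X s * q s := by
    ext m
    rw [map_sum]
    have hterm : ∀ (s : σ) (q : MvPowerSeries σ Λ), coeff m ((X s : MvPowerSeries σ Λ) * q) =
        if Finsupp.single s 1 ≤ m then coeff (m - Finsupp.single s 1) q else 0 := fun s q => by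
      rw [X, coeff_monomial_mul]; simp
    simp only [hterm]
    by_cases hm : m = 0
    · subst hm
      rw [Finset.sum_eq_zero]
      · simpa using hf
      · intro s _
        rw [if_neg]
        simp
    · rw [Finset.sum_eq_single (c m)]
      · have hle : Finsupp.single (c m) 1 ≤ m := by
          rw [Finsupp.single_le_iff]
          exact Nat.one_le_iff_ne_zero.mpr (hc m hm)
        rw [if_pos hle, hq, tsub_add_cancel_of_le hle, if_pos rfl]
      · intro s _ hs
        split_ifs with hle
        · rw [hq, tsub_add_cancel_of_le hle, if_neg (Ne.symm hs)]
        · rfl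
      · simp
  rw [hfsum]
  exact Ideal.sum_mem _ fun s _ => Ideal.mul_mem_right _ _ (Ideal.subset_span ⟨s, rfl⟩)

/-- Power series can be evaluated at finitely many nilpotent elements. -/
theorem exists_algHom_X_eq [Finite σ] {A : Type*} [CommRing A] [Algebra Λ A] (z : σ → A)
    (hz : ∀ s, IsNilpotent (z s)) : ∃ h : MvPowerSeries σ Λ →ₐ[Λ] A, ∀ s, h (X s) = z s := by
  -- For discrete topologies, topological nilpotence of the values follows from nilpotence, and the
  -- cofinite condition is empty because `σ` is finite.
  let : UniformSpace Λ := ⊥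
  let : UniformSpace A := ⊥
  have : DiscreteTopology Λ := ⟨rfl⟩
  have : DiscreteTopology A := ⟨rfl⟩
  have : IsUniformAddGroup Λ := inferInstance
  have : IsUniformAddGroup A := inferInstance
  have : IsTopologicalRing A := inferInstance
  have : IsLinearTopology A A := inferInstance
  have : ContinuousSMul Λ A := ⟨continuous_of_discreteTopology⟩
  have ha : HasEval z := ⟨fun s => (hz s).isTopologicallyNilpotent, by
    rw [Filter.cofinite_eq_bot]; exact Filter.tendsto_bot⟩
  refine ⟨aeval ha, fun s => ?_⟩
  have := aeval_coe ha (MvPolynomial.X (R := Λ) s)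
  simpa using this

end PowerSeries

/-! ### Deformations trivial on the kernel of `q` and their parameters -/

section ParametrizedDeformations

open Matrix

theorem exists_monoidHom_factor {I H M : Type*} [Group I] [Group H] [Monoid M] {q : I →* H}
    (hq : Function.Surjective q) (f : I →* M) (hf : ∀ i, q i = 1 → f i = 1) :
    ∃ f' : H →* M, ∀ i, f' (q i) = f i := by
  have hwd : ∀ i i', q i = q i' → f i = f i' := fun i i' h => by
    have h1 : f (i * i'⁻¹) = 1 := hf _ (by rw [map_mul, map_inv, h, mul_inv_cancel])
    rw [← one_mul (f i'), ← h1, ← map_mul, inv_mul_cancel_right]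
  refine ⟨⟨⟨fun h => f (Function.surjInv hq h), ?_⟩, fun h h' => ?_⟩, fun i => ?_⟩
  · exact hf _ (Function.surjInv_eq hq 1)
  · rw [← map_mul]
    exact hwd _ _ (by rw [map_mul]; simp only [Function.surjInv_eq])
  · exact hwd _ _ (Function.surjInv_eq hq _)

variable {G : Type*} [Group G]

/-- The image of a matrix representation under a ring homomorphism. -/
noncomputable abbrev mapRep {G A B : Type*} [Monoid G] [CommRing A] [CommRing B] {d : ℕ}
    (f : A →+* B) (r : G →* Matrix (Fin d) (Fin d) A) : G →* Matrix (Fin d) (Fin d) B :=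
  ((f.mapMatrix (m := Fin d) : Matrix (Fin d) (Fin d) A →+* Matrix (Fin d) (Fin d) B) :
    Matrix (Fin d) (Fin d) A →* Matrix (Fin d) (Fin d) B).comp r

theorem mapRep_apply {G A B : Type*} [Monoid G] [CommRing A] [CommRing B] {d : ℕ}
    (f : A →+* B) (r : G →* Matrix (Fin d) (Fin d) A) (g : G) : mapRep f r g = (r g).map f := rfl

/-- The kernel of the reduction of a matrix representation modulo an ideal. -/
noncomputable def congruenceSubgroup {A : Type*} [CommRing A] {d : ℕ}
    (r : G →* Matrix (Fin d) (Fin d) A) (J : Ideal A) : Subgroup G :=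
  (mapRep (Ideal.Quotient.mk J) r).ker

theorem mem_congruenceSubgroup {A : Type*} [CommRing A] {d : ℕ}
    {r : G →* Matrix (Fin d) (Fin d) A} {J : Ideal A} {g : G} :
    g ∈ congruenceSubgroup r J ↔ ∀ i j, (r g - 1) i j ∈ J := by
  rw [congruenceSubgroup, MonoidHom.mem_ker, ← sub_eq_zero, MonoidHom.comp_apply]
  change (Ideal.Quotient.mk J).mapMatrix (r g) - 1 = 0 ↔ _
  rw [← map_one (Ideal.Quotient.mk J).mapMatrix, ← map_sub, ← Matrix.ext_iff]
  exact forall₂_congr fun i j => Ideal.Quotient.eq_zero_iff_mem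

theorem isUnit_matrix_of_map {A : Type*} [CommRing A] {F : Type*} [Field F] {d : ℕ} (π : A →+* F)
    [IsLocalHom π] {M : Matrix (Fin d) (Fin d) A} (hM : IsUnit (M.map π)) : IsUnit M := by
  rw [Matrix.isUnit_iff_isUnit_det] at hM ⊢
  rw [← RingHom.mapMatrix_apply, ← RingHom.map_det] at hM
  exact (isUnit_map_iff π _).mp hM

variable {Λ : Type*} [CommRing Λ] {I : Subgroup G} {H : Type*} [Group H] {d : ℕ}

/-- The base change of a matrix representation to an algebra. -/
noncomputable abbrev baseChangeRep (ρ₀ : H →* Matrix (Fin d) (Fin d) Λ) (A : Type*) [CommRing A]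
    [Algebra Λ A] : H →* Matrix (Fin d) (Fin d) A :=
  mapRep (algebraMap Λ A) ρ₀

/-- The representation `r` of `G` has parameter `Z` with respect to the standard pair `(ρ₀, Ψ₀)`
of a representation of the quotient `H` of `I` and of the image of `φ`. -/
def RepHasParam (q : I →* H) (φ : G) (ρ₀ : H →* Matrix (Fin d) (Fin d) Λ)
    (Ψ₀ : Matrix (Fin d) (Fin d) Λ) {A : Type*} [CommRing A] [Algebra Λ A]
    (Z : Matrix (Fin d) (Fin d) A) (r : G →* Matrix (Fin d) (Fin d) A) : Prop :=
  ∃ rH : H →* Matrix (Fin d) (Fin d) A, (∀ i : I, rH (q i) = r i) ∧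
    HasParam (baseChangeRep ρ₀ A) (Ψ₀.map (algebraMap Λ A)) Z rH (r φ)

/-- The structure constants of the parametrisation of the deformations of a residual
representation `ρF`: a lift `(ρ₀, Ψ₀)` to `Λ` of its values on `I` and on `φ`. -/
structure IsStandardPair {F : Type*} [Field F] (q : I →* H) (φ : G) (θ : H →* H)
    (ρ₀ : H →* Matrix (Fin d) (Fin d) Λ) (Ψ₀ : Matrix (Fin d) (Fin d) Λ) (c : Λ →+* F)
    (ρF : G →* Matrix (Fin d) (Fin d) F) : Prop where
  isUnit_card : IsUnit (Nat.card H : Λ)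
  isUnit : IsUnit Ψ₀
  mul_eq : ∀ h, Ψ₀ * ρ₀ h = ρ₀ (θ h) * Ψ₀
  map_rep : ∀ i : I, (ρ₀ (q i)).map c = ρF i
  map_frob : Ψ₀.map c = ρF φ

omit [Group H] in
theorem isUnit_card_matrix [Finite H] {A : Type*} [CommRing A] [Algebra Λ A]
    (h : IsUnit (Nat.card H : Λ)) : IsUnit (Nat.card H : Matrix (Fin d) (Fin d) A) := by
  simpa using h.map ((Matrix.scalar (Fin d)).comp (algebraMap Λ A))

variable [Finite H] {F : Type*} [Field F] {q : I →* H} {φ : G} {θ : H →* H}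
  {ρ₀ : H →* Matrix (Fin d) (Fin d) Λ} {Ψ₀ : Matrix (Fin d) (Fin d) Λ} {c : Λ →+* F}
  {ρF : G →* Matrix (Fin d) (Fin d) F}

/-- Any set-theoretic lift of `ρF φ` becomes an intertwiner from `ρ₀` to `ρ₀ ∘ θ` after averaging.
Its reduction is unchanged, because `ρF φ` already intertwines the residual representations. -/
theorem exists_isStandardPair [I.Normal] [IsLocalHom c] (hc : Function.Surjective c)
    [IsAdicComplete (RingHom.ker c) Λ] (hq : Function.Surjective q)
    (hθ : ∀ i : I, q (MulAut.conjNormal φ i) = θ (q i)) (hH : IsUnit (Nat.card H : Λ))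
    (hρF : ∀ i : I, q i = 1 → ρF i = 1) :
    ∃ (ρ₀ : H →* Matrix (Fin d) (Fin d) Λ) (Ψ₀ : Matrix (Fin d) (Fin d) Λ),
      IsStandardPair q φ θ ρ₀ Ψ₀ c ρF := by
  obtain ⟨ρH, hρH⟩ := exists_monoidHom_factor hq (ρF.comp I.subtype) hρF
  obtain ⟨ρ₀, hρ₀⟩ := exists_rep_lift c hc hH ρH
  have hrep : ∀ i : I, (ρ₀ (q i)).map c = ρF i := fun i => by rw [hρ₀, hρH]; rfl
  have hΨ : ((groupAverage (ρ₀.comp θ) ρ₀ ((ρF φ).map (Function.surjInv hc)))).map c = ρF φ := by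
    rw [← RingHom.mapMatrix_apply, map_groupAverage _ (isUnit_card_matrix (A := Λ) hH)]
    have hB : c.mapMatrix ((ρF φ).map (Function.surjInv hc)) = ρF φ := by
      ext i j
      simp [Function.surjInv_eq hc]
    rw [hB]
    refine groupAverage_of_intertwines
      (by simpa using (isUnit_card_matrix (A := Λ) hH).map (c.mapMatrix (m := Fin d))) fun h => ?_
    obtain ⟨i, rfl⟩ := hq h
    change (ρ₀ (θ (q i))).map c * ρF φ = ρF φ * (ρ₀ (q i)).map c
    rw [← hθ, hrep, hrep, ← map_mul, ← map_mul, MulAut.conjNormal_apply]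
    congr 1
    group
  refine ⟨ρ₀, groupAverage (ρ₀.comp θ) ρ₀ ((ρF φ).map (Function.surjInv hc)), hH, ?_, fun h => ?_,
    hrep, hΨ⟩
  · refine isUnit_matrix_of_map c ?_
    rw [hΨ]
    exact (Group.isUnit φ).map ρF
  · exact (mul_groupAverage_self (ρ₀.comp θ) ρ₀ _ h).symm

namespace RepHasParam

variable {A B : Type*} [CommRing A] [Algebra Λ A] [CommRing B] [Algebra Λ B]
  {Z Z' : Matrix (Fin d) (Fin d) A} {r r' : G →* Matrix (Fin d) (Fin d) A}

omit [Finite H] in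
theorem eq_one (h : RepHasParam q φ ρ₀ Ψ₀ Z r) {i : I} (hi : q i = 1) : r i = 1 := by
  obtain ⟨rH, h1, -⟩ := h
  rw [← h1, hi, map_one]

theorem map (h : RepHasParam q φ ρ₀ Ψ₀ Z r) (hH : IsUnit (Nat.card H : Λ)) (f : A →ₐ[Λ] B) :
    RepHasParam q φ ρ₀ Ψ₀ (Z.map f) (mapRep (f : A →+* B) r) := by
  obtain ⟨rH, h1, h2⟩ := h
  have h3 := h2.map (f : A →+* B).mapMatrix (isUnit_card_matrix hH)
  refine ⟨mapRep (f : A →+* B) rH, fun i => by rw [mapRep_apply, mapRep_apply, h1], ?_⟩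
  have e1 : baseChangeRep ρ₀ B = mapRep (f : A →+* B) (baseChangeRep ρ₀ A) := by
    ext h i j
    exact (f.commutes _).symm
  have e2 : Ψ₀.map (algebraMap Λ B) = (f : A →+* B).mapMatrix (Ψ₀.map (algebraMap Λ A)) := by
    ext i j
    exact (f.commutes _).symm
  rw [e1, e2]
  exact h3

theorem param_eq (h : RepHasParam q φ ρ₀ Ψ₀ Z r) (h' : RepHasParam q φ ρ₀ Ψ₀ Z' r)
    (hq : Function.Surjective q) (hs : IsStandardPair q φ θ ρ₀ Ψ₀ c ρF)
    (hu : IsUnit (conjParam (baseChangeRep ρ₀ A) Z)) : Z = Z' := by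
  obtain ⟨rH, h1, h2⟩ := h
  obtain ⟨rH', h1', h2'⟩ := h'
  have : rH = rH' := by
    ext x : 1
    obtain ⟨i, rfl⟩ := hq x
    rw [h1, h1']
  subst this
  exact h2.eq_param h2' (isUnit_card_matrix hs.isUnit_card)
    (hs.isUnit.map (algebraMap Λ A).mapMatrix) hu

omit [Finite H] in
-- The parameter fixes the values on `I` and at `φ`; since both kernels are open, these values fix
-- the representation.
theorem rep_eq [TopologicalSpace G] {I' : Subgroup G} (hφ : IsFrobeniusLift I I' φ)
    (h : RepHasParam q φ ρ₀ Ψ₀ Z r) (h' : RepHasParam q φ ρ₀ Ψ₀ Z r')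
    (hu : IsUnit (conjParam (baseChangeRep ρ₀ A) Z)) (hr : IsOpen (r.ker : Set G))
    (hr' : IsOpen (r'.ker : Set G)) : r = r' := by
  obtain ⟨rH, h1, h2⟩ := h
  obtain ⟨rH', h1', h2'⟩ := h'
  obtain ⟨h3, h4⟩ := h2.eq_rep h2' hu
  exact hφ.monoidHom_eq hr hr' (fun _ h => h) (fun _ h => h)
    (fun i hi => by rw [← h1 ⟨i, hi⟩, ← h1' ⟨i, hi⟩, h3]) h4

end RepHasParam

namespace IsStandardPair

variable {A : Type*} [CommRing A] [Algebra Λ A] (hs : IsStandardPair q φ θ ρ₀ Ψ₀ c ρF)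

include hs in
omit [Finite H] in
theorem map_baseChangeRep {π : A →+* F} (hπ : π.comp (algebraMap Λ A) = c) (i : I) :
    (baseChangeRep ρ₀ A (q i)).map π = ρF i := by
  rw [← hs.map_rep, ← hπ]
  rfl

include hs in
omit [Finite H] in
theorem map_baseChange_frob {π : A →+* F} (hπ : π.comp (algebraMap Λ A) = c) :
    (Ψ₀.map (algebraMap Λ A)).map π = ρF φ := by
  rw [← hs.map_frob, ← hπ]
  ext
  simp

end IsStandardPair

/-- Every deformation that is trivial on the kernel of `q` has a parameter. -/
theorem exists_repHasParam {A : Type*} [CommRing A] [Algebra Λ A] [I.Normal]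
    (hs : IsStandardPair q φ θ ρ₀ Ψ₀ c ρF) (hq : Function.Surjective q)
    (hθ : ∀ i : I, q (MulAut.conjNormal φ i) = θ (q i)) {π : A →+* F} [IsLocalHom π]
    (hπ : π.comp (algebraMap Λ A) = c) {r : G →* Matrix (Fin d) (Fin d) A}
    (hr : ∀ g, (r g).map π = ρF g) (hr1 : ∀ i : I, q i = 1 → r i = 1) :
    ∃ Z, Z.map π = 0 ∧ RepHasParam q φ ρ₀ Ψ₀ Z r := by
  obtain ⟨rH, hrH⟩ := exists_monoidHom_factor hq (r.comp I.subtype) hr1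
  have hrH' : ∀ i : I, rH (q i) = r i := hrH
  have hHA := isUnit_card_matrix (d := d) (A := A) hs.isUnit_card
  have hred : ∀ h, π.mapMatrix (rH h) = π.mapMatrix (baseChangeRep ρ₀ A h) := fun h => by
    obtain ⟨i, rfl⟩ := hq h
    rw [hrH']
    exact (hr _).trans (hs.map_baseChangeRep hπ i).symm
  obtain ⟨Z, hZ, hZr⟩ := exists_hasParam (ρ₀ := baseChangeRep ρ₀ A) (θ := θ) (r := rH) (F := r φ)
    hHA (hs.isUnit.map (algebraMap Λ A).mapMatrix) (fun h => by
      have := congrArg (algebraMap Λ A).mapMatrix (hs.mul_eq h)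
      rwa [map_mul, map_mul] at this) (fun h => by
      obtain ⟨i, rfl⟩ := hq h
      rw [← hθ, hrH', hrH', ← map_mul, ← map_mul, MulAut.conjNormal_apply]
      congr 1
      group) (by
      -- The averaged intertwiner reduces to the identity, since `rH` and `ρ₀` have the same
      -- reduction.
      refine isUnit_matrix_of_map π ?_
      rw [← RingHom.mapMatrix_apply, map_groupAverage _ hHA, map_one,
        groupAverage_of_intertwines (by simpa using hHA.map (π.mapMatrix (m := Fin d)))]
      · exact isUnit_one
      · intro h
        rw [mul_one, one_mul]
        exact hred h) π.mapMatrix hred ((hr φ).trans (hs.map_baseChange_frob hπ).symm)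
  exact ⟨Z, hZ, rH, hrH', hZr⟩

theorem isUnit_conjParam {A : Type*} [CommRing A] [Algebra Λ A] (hH : IsUnit (Nat.card H : Λ))
    (π : A →+* F) [IsLocalHom π] {Z : Matrix (Fin d) (Fin d) A} (hZ : Z.map π = 0) :
    IsUnit (conjParam (baseChangeRep ρ₀ A) Z) := by
  refine isUnit_matrix_of_map π ?_
  rw [← RingHom.mapMatrix_apply, map_conjParam _ (isUnit_card_matrix hH), RingHom.mapMatrix_apply,
    hZ, conjParam_zero]
  exact isUnit_one

theorem isUnit_frobParam {A : Type*} [CommRing A] [Algebra Λ A]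
    (hs : IsStandardPair q φ θ ρ₀ Ψ₀ c ρF) (π : A →+* F) [IsLocalHom π]
    {Z : Matrix (Fin d) (Fin d) A} (hZ : Z.map π = 0) :
    IsUnit (frobParam (baseChangeRep ρ₀ A) (Ψ₀.map (algebraMap Λ A)) Z) := by
  refine isUnit_matrix_of_map π ?_
  rw [← RingHom.mapMatrix_apply, map_frobParam _ (isUnit_card_matrix hs.isUnit_card),
    RingHom.mapMatrix_apply, RingHom.mapMatrix_apply, hZ, frobParam_zero]
  exact (hs.isUnit.map (algebraMap Λ A).mapMatrix).map π.mapMatrix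

/-- Every parameter over a finite ring that reduces to zero comes from a deformation. -/
theorem exists_rep_repHasParam [TopologicalSpace G] {I' : Subgroup G} {A : Type*} [CommRing A]
    [Algebra Λ A] [Finite A] [I.Normal] (hφ : IsFrobeniusLift I I' φ)
    (hI' : ∀ i : I, (i : G) ∈ I' → q i = 1) (hs : IsStandardPair q φ θ ρ₀ Ψ₀ c ρF)
    (hθ : ∀ i : I, q (MulAut.conjNormal φ i) = θ (q i)) {π : A →+* F} [IsLocalHom π] (hπ : π.comp (algebraMap Λ A) = c)
    (hρF : IsOpen (ρF.ker : Set G)) [ContinuousMul G]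
    {Z : Matrix (Fin d) (Fin d) A} (hZ : Z.map π = 0) :
    ∃ r : G →* Matrix (Fin d) (Fin d) A, IsOpen (r.ker : Set G) ∧ RepHasParam q φ ρ₀ Ψ₀ Z r ∧
      ∀ g, (r g).map π = ρF g := by
  obtain ⟨Y, hY⟩ := isUnit_conjParam (ρ₀ := ρ₀) hs.isUnit_card π hZ
  obtain ⟨Ψ, hΨ⟩ := isUnit_frobParam hs π hZ
  -- `Ψ = Ψ₀ (1 + e(Z))` has the same intertwining property as `Ψ₀` because `e(Z)` commutes with
  -- `ρ₀`. Conjugating `ρ₀` and `Ψ` by `Y⁻¹` therefore gives compatible values on `I` and at `φ`.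
  have hΨρ : ∀ h, (Ψ : Matrix (Fin d) (Fin d) A) * baseChangeRep ρ₀ A h =
      baseChangeRep ρ₀ A (θ h) * Ψ := fun h => by
    have h1 : Ψ₀.map (algebraMap Λ A) * baseChangeRep ρ₀ A h =
        baseChangeRep ρ₀ A (θ h) * Ψ₀.map (algebraMap Λ A) := by
      have := congrArg (algebraMap Λ A).mapMatrix (hs.mul_eq h)
      rwa [map_mul, map_mul] at this
    have h2 := mul_groupAverage_self (baseChangeRep ρ₀ A) (baseChangeRep ρ₀ A) Z h
    rw [hΨ, frobParam, mul_assoc, add_mul, one_mul, ← h2, ← mul_assoc, ← h1, mul_assoc,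
      mul_add (baseChangeRep ρ₀ A h), mul_one]
  let ρu : H →* (Matrix (Fin d) (Fin d) A)ˣ := (baseChangeRep ρ₀ A).toHomUnits
  have hρu : ∀ h, (ρu h : Matrix (Fin d) (Fin d) A) = baseChangeRep ρ₀ A h := fun h => rfl
  have hΨu : ∀ h, Ψ * ρu h = ρu (θ h) * Ψ := fun h => Units.ext (hΨρ h)
  let α : I →* (Matrix (Fin d) (Fin d) A)ˣ := ((MulAut.conj Y⁻¹).toMonoidHom.comp ρu).comp q
  have hα : ∀ i, α i = Y⁻¹ * ρu (q i) * Y := fun i => by simp [α]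
  obtain ⟨f, hfI, hfφ, U, hU, hfU⟩ := hφ.exists_monoidHom α
    (fun i hi => by rw [hα, hI' i hi]; simp) (Y⁻¹ * Ψ * Y) (fun i => by
      rw [hα, hα, hθ, ← mul_inv_eq_iff_eq_mul.mpr (hΨu (q i))]; group)
  let r : G →* Matrix (Fin d) (Fin d) A := (Units.coeHom _).comp f
  have hrI : ∀ i : I, r i = ((Y⁻¹ * ρu (q i) * Y : (Matrix (Fin d) (Fin d) A)ˣ) :
      Matrix (Fin d) (Fin d) A) := fun i => by rw [← hα, ← hfI]; rfl
  have hrφ : r φ = ((Y⁻¹ * Ψ * Y : (Matrix (Fin d) (Fin d) A)ˣ) : Matrix (Fin d) (Fin d) A) := by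
    rw [← hfφ]; rfl
  have hropen : IsOpen (r.ker : Set G) := Subgroup.isOpen_mono (H₁ := U) (fun u hu => by
    rw [MonoidHom.mem_ker]
    change ((f u : (Matrix (Fin d) (Fin d) A)ˣ) : Matrix (Fin d) (Fin d) A) = 1
    rw [hfU u hu, Units.val_one]) hU
  have hYπ : (Y : Matrix (Fin d) (Fin d) A).map π = 1 := by
    rw [hY, ← RingHom.mapMatrix_apply, map_conjParam _ (isUnit_card_matrix hs.isUnit_card),
      RingHom.mapMatrix_apply, hZ, conjParam_zero]
  have hYπ' : ((Y⁻¹ : (Matrix (Fin d) (Fin d) A)ˣ) : Matrix (Fin d) (Fin d) A).map π = 1 := by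
    have := congrArg π.mapMatrix Y.inv_mul
    rw [map_mul, map_one, RingHom.mapMatrix_apply, RingHom.mapMatrix_apply, hYπ, mul_one] at this
    exact this
  have hΨπ : (Ψ : Matrix (Fin d) (Fin d) A).map π = ρF φ := by
    rw [hΨ, ← RingHom.mapMatrix_apply, map_frobParam _ (isUnit_card_matrix hs.isUnit_card),
      RingHom.mapMatrix_apply, RingHom.mapMatrix_apply, hZ, frobParam_zero,
      hs.map_baseChange_frob hπ]
  refine ⟨r, hropen, ⟨(Units.coeHom _).comp ((MulAut.conj Y⁻¹).toMonoidHom.comp ρu), fun i => ?_,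
    fun h => ?_, ?_⟩, fun g => ?_⟩
  · rw [hrI, ← hα]; rfl
  · rw [← hY, ← hρu]
    change ((Y * (Y⁻¹ * ρu h * Y⁻¹⁻¹) : (Matrix (Fin d) (Fin d) A)ˣ) : Matrix (Fin d) (Fin d) A) =
      ((ρu h * Y : (Matrix (Fin d) (Fin d) A)ˣ) : Matrix (Fin d) (Fin d) A)
    congr 1
    group
  · rw [← hY, ← hΨ, hrφ]
    change ((Y * (Y⁻¹ * Ψ * Y) : (Matrix (Fin d) (Fin d) A)ˣ) : Matrix (Fin d) (Fin d) A) =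
      ((Ψ * Y : (Matrix (Fin d) (Fin d) A)ˣ) : Matrix (Fin d) (Fin d) A)
    congr 1
    group
  · have : mapRep π r = ρF := by
      refine hφ.monoidHom_eq hropen hρF (fun u hu => ?_) (fun _ h => h) (fun i hi => ?_) ?_
      · rw [MonoidHom.comp_apply, MonoidHom.mem_ker.mp hu, map_one]
      · have h1 := hrI ⟨i, hi⟩
        simp only at h1
        rw [MonoidHom.comp_apply, h1]
        change ((Y⁻¹ * ρu (q ⟨i, hi⟩) * Y : (Matrix (Fin d) (Fin d) A)ˣ) :
          Matrix (Fin d) (Fin d) A).map π = _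
        rw [Units.val_mul, Units.val_mul, Matrix.map_mul, Matrix.map_mul, hYπ, hYπ', one_mul,
          mul_one, hρu, hs.map_baseChangeRep hπ]
      · rw [MonoidHom.comp_apply, hrφ]
        change ((Y⁻¹ * Ψ * Y : (Matrix (Fin d) (Fin d) A)ˣ) : Matrix (Fin d) (Fin d) A).map π = _
        rw [Units.val_mul, Units.val_mul, Matrix.map_mul, Matrix.map_mul, hYπ, hYπ', one_mul,
          mul_one, hΨπ]
    rw [← this]
    rfl

end ParametrizedDeformations

/-! ### Continuity, and uniqueness of maps from the universal ring -/

section UniversalRing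

open Matrix

theorem isLocalHom_of_surjective_field {A F : Type*} [CommRing A] [IsLocalRing A] [Field F]
    {π : A →+* F} (hπ : Function.Surjective π) : IsLocalHom π := by
  refine ⟨fun a ha => ?_⟩
  by_contra h
  have h1 : a ∈ IsLocalRing.maximalIdeal A := (IsLocalRing.mem_maximalIdeal a).mpr h
  have := RingHom.ker_isMaximal_of_surjective π hπ
  rw [← IsLocalRing.eq_maximalIdeal this, RingHom.mem_ker] at h1
  rw [h1] at ha
  exact not_isUnit_zero ha

theorem ker_eq_maximalIdeal_of_surjective {A F : Type*} [CommRing A] [IsLocalRing A] [Field F]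
    {π : A →+* F} (hπ : Function.Surjective π) : RingHom.ker π = IsLocalRing.maximalIdeal A :=
  IsLocalRing.eq_maximalIdeal (RingHom.ker_isMaximal_of_surjective π hπ)

variable {p : ℕ} [Fact p.Prime] {𝔽 : Type u} [Field 𝔽]

theorem IsLocalWittAlgebra.surjective {A : Type u} [CommRing A] [Algebra (WittVector p 𝔽) A]
    {π : A →+* 𝔽} (h : IsLocalWittAlgebra p π) : Function.Surjective π := by
  have h1 : Function.Surjective (π.comp (algebraMap (WittVector p 𝔽) A)) := by
    rw [h.comp_eq]
    exact WittVector.constantCoeff_surjective p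
  exact Function.Surjective.of_comp h1

theorem IsLocalWittAlgebra.isLocalHom {A : Type u} [CommRing A] [Algebra (WittVector p 𝔽) A]
    {π : A →+* 𝔽} (h : IsLocalWittAlgebra p π) : IsLocalHom π :=
  have := h.isLocalRing
  isLocalHom_of_surjective_field h.surjective

variable {G : Type*} [Group G] [TopologicalSpace G] [IsTopologicalGroup G]
  {V : Type*} [AddCommGroup V] [Module 𝔽 V] {d : ℕ}
  {ρbar : Representation 𝔽 G V} {β : Module.Basis (Fin d) 𝔽 V}

/-- The matrix form of a representation. -/
noncomputable def matrixRep (ρbar : Representation 𝔽 G V) (β : Module.Basis (Fin d) 𝔽 V) :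
    G →* Matrix (Fin d) (Fin d) 𝔽 where
  toFun g := LinearMap.toMatrix β β (ρbar g)
  map_one' := by rw [map_one, Module.End.one_eq_id, LinearMap.toMatrix_id]
  map_mul' g h := by rw [map_mul, LinearMap.toMatrix_mul]

theorem isFramedDeformation_of_isOpen_ker {A : Type u} [CommRing A] {π : A →+* 𝔽}
    {r : G →* Matrix (Fin d) (Fin d) A} (hr : IsOpen (r.ker : Set G))
    (hπ : ∀ g, (r g).map π = matrixRep ρbar β g) : IsFramedDeformation ρbar β π r where
  continuous n := by
    have : {g : G | ∀ i j, (r g - 1) i j ∈ RingHom.ker π ^ n} =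
        (congruenceSubgroup r (RingHom.ker π ^ n) : Set G) := by
      ext g
      exact mem_congruenceSubgroup.symm
    rw [this]
    refine Subgroup.isOpen_mono (fun g hg => mem_congruenceSubgroup.mpr fun i j => ?_) hr
    rw [MonoidHom.mem_ker.mp hg, sub_self]
    exact Ideal.zero_mem _
  reduces := hπ

theorem IsFramedDeformation.isOpen_congruenceSubgroup {A : Type u} [CommRing A] {π : A →+* 𝔽}
    {r : G →* Matrix (Fin d) (Fin d) A} (hr : IsFramedDeformation ρbar β π r) {J : Ideal A} {n : ℕ}
    (hJ : RingHom.ker π ^ n ≤ J) : IsOpen (congruenceSubgroup r J : Set G) := by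
  have : IsOpen (congruenceSubgroup r (RingHom.ker π ^ n) : Set G) := by
    convert hr.continuous n using 1
    ext g
    exact mem_congruenceSubgroup
  exact Subgroup.isOpen_mono (fun g hg => mem_congruenceSubgroup.mpr fun i j =>
    hJ (mem_congruenceSubgroup.mp hg i j)) this

theorem IsFramedDeformation.isOpen_ker_matrixRep {A : Type u} [CommRing A] {π : A →+* 𝔽}
    {r : G →* Matrix (Fin d) (Fin d) A} (hr : IsFramedDeformation ρbar β π r) :
    IsOpen ((matrixRep ρbar β).ker : Set G) := by
  refine Subgroup.isOpen_mono (fun g hg => ?_)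
    (hr.isOpen_congruenceSubgroup (n := 1) (pow_one (RingHom.ker π)).le)
  have h1 := mem_congruenceSubgroup.mp hg
  rw [MonoidHom.mem_ker]
  refine (hr.reduces g).symm.trans (sub_eq_zero.mp ?_)
  rw [← RingHom.mapMatrix_apply, ← map_one π.mapMatrix, ← map_sub]
  ext i j
  exact h1 i j

/-- The image of a framed deformation under a local homomorphism to a ring whose maximal ideal is
nilpotent is trivial on an open subgroup. -/
theorem IsFramedDeformation.isOpen_ker_mapRep {A B : Type u} [CommRing A] {π : A →+* 𝔽}
    {r : G →* Matrix (Fin d) (Fin d) A} (hr : IsFramedDeformation ρbar β π r) [CommRing B]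
    {f : A →+* B} {n : ℕ} (hf : RingHom.ker π ^ n ≤ RingHom.ker f) :
    IsOpen ((mapRep f r).ker : Set G) := by
  refine Subgroup.isOpen_mono (fun g hg => ?_) (hr.isOpen_congruenceSubgroup hf)
  have h1 := mem_congruenceSubgroup.mp hg
  rw [MonoidHom.mem_ker, mapRep_apply, ← sub_eq_zero, ← RingHom.mapMatrix_apply,
    ← map_one f.mapMatrix, ← map_sub]
  ext i j
  exact h1 i j

/-- A map compatible with the residue maps sends `ker π` into the nilpotent ideal `ker πB`. With
this, adic continuity of a deformation turns into openness of the kernel of its image. -/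
theorem pow_ker_le_ker_of_comp_eq {A B : Type u} [CommRing A] [CommRing B] {π : A →+* 𝔽}
    {πB : B →+* 𝔽} {f : A →+* B} (hf : πB.comp f = π) {n : ℕ} (hn : RingHom.ker πB ^ n = ⊥) :
    RingHom.ker π ^ n ≤ RingHom.ker f := by
  have h1 : (RingHom.ker π).map f ≤ RingHom.ker πB := by
    rw [Ideal.map_le_iff_le_comap]
    intro x hx
    rw [Ideal.mem_comap, RingHom.mem_ker, ← RingHom.comp_apply, hf]
    exact hx
  intro x hx
  have h2 := Ideal.mem_map_of_mem f hx
  rw [Ideal.map_pow] at h2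
  have h3 := Ideal.pow_right_mono h1 n h2
  rw [hn] at h3
  exact h3

theorem IsLocalWittAlgebra.exists_pow_ker_eq_bot {A : Type u} [CommRing A] [IsArtinianRing A]
    [Algebra (WittVector p 𝔽) A] {π : A →+* 𝔽} (h : IsLocalWittAlgebra p π) :
    ∃ n, RingHom.ker π ^ n = ⊥ := by
  have := h.isLocalRing
  obtain ⟨n, hn⟩ := IsArtinianRing.isNilpotent_jacobson_bot (R := A)
  rw [IsLocalRing.jacobson_eq_maximalIdeal _ bot_ne_top,
    ← ker_eq_maximalIdeal_of_surjective h.surjective] at hn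
  exact ⟨n, hn⟩

variable {R : Type u} [CommRing R] [Algebra (WittVector p 𝔽) R] {π : R →+* 𝔽}
  {r : G →* Matrix (Fin d) (Fin d) R}

/-- Homomorphisms from the universal deformation ring are determined by the deformation. -/
theorem IsUniversalFramedDeformation.algHom_eq (hR : IsUniversalFramedDeformation p ρbar β π r)
    {A : Type u} [CommRing A] [IsArtinianRing A] [Algebra (WittVector p 𝔽) A] {πA : A →+* 𝔽}
    (hA : IsLocalWittAlgebra p πA) {f f' : R →ₐ[WittVector p 𝔽] A}
    (hf : πA.comp (f : R →+* A) = π) (hf' : πA.comp (f' : R →+* A) = π)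
    (h : mapRep (f : R →+* A) r = mapRep (f' : R →+* A) r) : f = f' := by
  obtain ⟨n, hn⟩ := hA.exists_pow_ker_eq_bot
  have hdef : IsFramedDeformation ρbar β πA (mapRep (f : R →+* A) r) := by
    refine isFramedDeformation_of_isOpen_ker
      (hR.isFramedDeformation.isOpen_ker_mapRep (pow_ker_le_ker_of_comp_eq hf hn)) fun g => ?_
    rw [mapRep_apply, Matrix.map_map, ← RingHom.coe_comp, hf]
    exact hR.isFramedDeformation.reduces g
  exact (hR.universal A πA _ hA hdef).unique ⟨hf, fun g => rfl⟩
    ⟨hf', fun g => (congrArg (fun s => s g) h).symm⟩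

end UniversalRing

/-! ### The map from the universal ring to power series -/

section UniversalParameter

open Matrix MvPowerSeries

variable {p : ℕ} [Fact p.Prime] {𝔽 : Type u} [Field 𝔽]

/-- The residue map of the power series ring over the Witt vectors. -/
noncomputable def residueMap (p : ℕ) [Fact p.Prime] (𝔽 : Type u) [Field 𝔽] (σ : Type*) :
    MvPowerSeries σ (WittVector p 𝔽) →+* 𝔽 :=
  (WittVector.constantCoeff : WittVector p 𝔽 →+* 𝔽).comp MvPowerSeries.constantCoeff

theorem residueMap_comp_algebraMap (σ : Type*) :
    (residueMap p 𝔽 σ).comp (algebraMap (WittVector p 𝔽) _) = WittVector.constantCoeff := by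
  ext x
  simp [residueMap, MvPowerSeries.algebraMap_apply]

/-- The index is `n + 1` because the truncation ideal at `0` is the whole ring. -/
theorem truncIdeal_le_ker_residueMap (σ : Type*) (n : ℕ) :
    truncIdeal σ (RingHom.ker (WittVector.constantCoeff : WittVector p 𝔽 →+* 𝔽)) (n + 1) ≤
      RingHom.ker (residueMap p 𝔽 σ) := by
  intro f hf
  have h := hf 0 (by simp)
  have h1 : coeff 0 f ∈ RingHom.ker (WittVector.constantCoeff : WittVector p 𝔽 →+* 𝔽) :=
    Ideal.pow_le_self n.succ_ne_zero h
  exact h1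

/-- The matrix of variables. -/
noncomputable def genericMatrix (d : ℕ) (Λ : Type*) [CommRing Λ] :
    Matrix (Fin d) (Fin d) (MvPowerSeries (Fin d × Fin d) Λ) := of fun i j => X (i, j)

theorem genericMatrix_map_residueMap (d : ℕ) :
    (genericMatrix d (WittVector p 𝔽)).map (residueMap p 𝔽 (Fin d × Fin d)) = 0 := by
  ext i j
  simp [genericMatrix, residueMap]

variable [Finite 𝔽] [CharP 𝔽 p]

instance isAdicComplete_ker_constantCoeff :
    IsAdicComplete (RingHom.ker (WittVector.constantCoeff : WittVector p 𝔽 →+* 𝔽))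
      (WittVector p 𝔽) := by
  rw [WittVector.ker_constantCoeff]
  infer_instance

instance isLocalHom_constantCoeff :
    IsLocalHom (WittVector.constantCoeff : WittVector p 𝔽 →+* 𝔽) :=
  isLocalHom_of_surjective_field (WittVector.constantCoeff_surjective p)

theorem finite_quotient_truncIdeal_witt (σ : Type*) [Finite σ] (n : ℕ) :
    Finite (MvPowerSeries σ (WittVector p 𝔽) ⧸
      truncIdeal σ (RingHom.ker (WittVector.constantCoeff : WittVector p 𝔽 →+* 𝔽)) n) := by
  have : Finite (WittVector p 𝔽 ⧸ RingHom.ker (WittVector.constantCoeff : WittVector p 𝔽 →+* 𝔽)) :=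
    (RingHom.quotientKerEquivOfSurjective (WittVector.constantCoeff_surjective p)).toEquiv.finite_iff.mpr
      inferInstance
  refine finite_quotient_truncIdeal ?_ n
  rw [WittVector.ker_constantCoeff]
  exact ⟨{(p : WittVector p 𝔽)}, by simp⟩

omit [Finite 𝔽] [CharP 𝔽 p] in
theorem surjective_residueMap (σ : Type*) : Function.Surjective (residueMap p 𝔽 σ) := by
  refine Function.Surjective.of_comp (g := algebraMap (WittVector p 𝔽) _) ?_
  rw [← RingHom.coe_comp, residueMap_comp_algebraMap]
  exact WittVector.constantCoeff_surjective p

instance isLocalHom_residueMap (σ : Type*) : IsLocalHom (residueMap p 𝔽 σ) :=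
  isLocalHom_of_surjective_field (surjective_residueMap σ)

omit [Finite 𝔽] [CharP 𝔽 p] in
/-- The residue map of a quotient of the power series ring by a proper ideal. -/
theorem isLocalWittAlgebra_quotient {A : Type u} [CommRing A] [Algebra (WittVector p 𝔽) A]
    {π : A →+* 𝔽} (h : IsLocalWittAlgebra p π) {J : Ideal A} (hJ : J ≤ RingHom.ker π) :
    IsLocalWittAlgebra p (Ideal.Quotient.lift J π fun _ ha => RingHom.mem_ker.mp (hJ ha)) where
  isLocalRing := by
    have := h.isLocalRing
    have : Nontrivial (A ⧸ J) := Ideal.Quotient.nontrivial_iff.mpr fun h1 =>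
      RingHom.ker_ne_top π (top_le_iff.mp (h1 ▸ hJ))
    exact IsLocalRing.of_surjective' _ Ideal.Quotient.mk_surjective
  comp_eq := by
    rw [← h.comp_eq]
    ext x
    rfl

theorem isLocalWittAlgebra_residueMap (σ : Type) : IsLocalWittAlgebra p (residueMap p 𝔽 σ) :=
  ⟨inferInstance, residueMap_comp_algebraMap σ⟩

variable (p 𝔽) in
/-- The power series ring in the entries of a `d × d` matrix. -/
abbrev MatrixPowerSeries (d : ℕ) : Type u :=
  MvPowerSeries (Fin d × Fin d) (WittVector p 𝔽)

variable (p 𝔽) in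
/-- The ideals defining the truncations of the power series ring. -/
noncomputable abbrev wittTruncIdeal (d n : ℕ) : Ideal (MatrixPowerSeries p 𝔽 d) :=
  truncIdeal (Fin d × Fin d) (RingHom.ker (WittVector.constantCoeff : WittVector p 𝔽 →+* 𝔽)) n

variable (p 𝔽) in
/-- The residue map of a truncation of the power series ring. -/
noncomputable def truncResidueMap (d n : ℕ) :
    MatrixPowerSeries p 𝔽 d ⧸ wittTruncIdeal p 𝔽 d (n + 1) →+* 𝔽 :=
  Ideal.Quotient.lift _ (residueMap p 𝔽 (Fin d × Fin d)) fun _ ha =>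
    RingHom.mem_ker.mp (truncIdeal_le_ker_residueMap _ n ha)

omit [Finite 𝔽] [CharP 𝔽 p] in
theorem truncResidueMap_mk (d n : ℕ) (f : MatrixPowerSeries p 𝔽 d) :
    truncResidueMap p 𝔽 d n (Ideal.Quotient.mk _ f) = residueMap p 𝔽 (Fin d × Fin d) f := rfl

theorem isLocalWittAlgebra_truncResidueMap (d n : ℕ) :
    IsLocalWittAlgebra p (truncResidueMap p 𝔽 d n) :=
  isLocalWittAlgebra_quotient (isLocalWittAlgebra_residueMap _) (truncIdeal_le_ker_residueMap _ n)

variable {G : Type*} [Group G] [TopologicalSpace G] [IsTopologicalGroup G]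
  {V : Type*} [AddCommGroup V] [Module 𝔽 V] {d : ℕ}
  {ρbar : Representation 𝔽 G V} {β : Module.Basis (Fin d) 𝔽 V}
  {R : Type u} [CommRing R] [Algebra (WittVector p 𝔽) R] {π : R →+* 𝔽}
  {r : G →* Matrix (Fin d) (Fin d) R} {I I' : Subgroup G} {φ : G} {H : Type*} [Group H] [Finite H]
  {q : I →* H} {θ : H →* H} {ρ₀ : H →* Matrix (Fin d) (Fin d) (WittVector p 𝔽)}
  {Ψ₀ : Matrix (Fin d) (Fin d) (WittVector p 𝔽)}

/-- The homomorphism to a truncation of the power series ring given by the deformation whose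
parameter is the matrix of variables. -/
theorem IsUniversalFramedDeformation.exists_algHom_truncation [I.Normal]
    (hR : IsUniversalFramedDeformation p ρbar β π r) (hφ : IsFrobeniusLift I I' φ)
    (hI' : ∀ i : I, (i : G) ∈ I' → q i = 1)
    (hs : IsStandardPair q φ θ ρ₀ Ψ₀ WittVector.constantCoeff (matrixRep ρbar β))
    (hθ : ∀ i : I, q (MulAut.conjNormal φ i) = θ (q i)) (n : ℕ) :
    ∃ f : R →ₐ[WittVector p 𝔽] MatrixPowerSeries p 𝔽 d ⧸ wittTruncIdeal p 𝔽 d (n + 1),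
      (truncResidueMap p 𝔽 d n).comp (f : R →+* MatrixPowerSeries p 𝔽 d ⧸ wittTruncIdeal p 𝔽 d (n + 1)) = π ∧
      RepHasParam q φ ρ₀ Ψ₀ ((genericMatrix d (WittVector p 𝔽)).map
        (Ideal.Quotient.mk (wittTruncIdeal p 𝔽 d (n + 1)))) (mapRep (f : R →+* MatrixPowerSeries p 𝔽 d ⧸ wittTruncIdeal p 𝔽 d (n + 1)) r) ∧
      IsOpen (MonoidHom.ker (mapRep
        (f : R →+* MatrixPowerSeries p 𝔽 d ⧸ wittTruncIdeal p 𝔽 d (n + 1)) r) : Set G) := by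
  have := finite_quotient_truncIdeal_witt (p := p) (𝔽 := 𝔽) (Fin d × Fin d) (n + 1)
  have hloc := isLocalWittAlgebra_truncResidueMap (p := p) (𝔽 := 𝔽) d n
  have := hloc.isLocalHom
  obtain ⟨rA, hopen, hparam, hred⟩ := exists_rep_repHasParam hφ hI' hs hθ hloc.comp_eq
    hR.isFramedDeformation.isOpen_ker_matrixRep
    (Z := (genericMatrix d (WittVector p 𝔽)).map
      (Ideal.Quotient.mk (wittTruncIdeal p 𝔽 d (n + 1)))) (by
      exact genericMatrix_map_residueMap (p := p) (𝔽 := 𝔽) d)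
  obtain ⟨f, ⟨hf, hfr⟩, -⟩ := hR.universal _ _ rA hloc
    (isFramedDeformation_of_isOpen_ker hopen hred)
  obtain rfl : mapRep (f : R →+* _) r = rA := MonoidHom.ext hfr
  exact ⟨f, hf, hparam, hopen⟩

/-- The homomorphism to the power series ring whose deformation has the matrix of variables as
parameter. -/
theorem IsUniversalFramedDeformation.exists_algHom_powerSeries [I.Normal]
    (hR : IsUniversalFramedDeformation p ρbar β π r) (hφ : IsFrobeniusLift I I' φ)
    (hI' : ∀ i : I, (i : G) ∈ I' → q i = 1)
    (hs : IsStandardPair q φ θ ρ₀ Ψ₀ WittVector.constantCoeff (matrixRep ρbar β))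
    (hθ : ∀ i : I, q (MulAut.conjNormal φ i) = θ (q i)) (hq : Function.Surjective q) :
    ∃ g : R →ₐ[WittVector p 𝔽] MatrixPowerSeries p 𝔽 d,
      (residueMap p 𝔽 (Fin d × Fin d)).comp (g : R →+* _) = π ∧
      RepHasParam q φ ρ₀ Ψ₀ (genericMatrix d (WittVector p 𝔽)) (mapRep (g : R →+* _) r) := by
  choose f hfπ hfr hfo using hR.exists_algHom_truncation hφ hI' hs hθ
  let fac : ∀ n, MatrixPowerSeries p 𝔽 d ⧸ wittTruncIdeal p 𝔽 d (n + 1) →ₐ[WittVector p 𝔽]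
      MatrixPowerSeries p 𝔽 d ⧸ wittTruncIdeal p 𝔽 d n := fun n =>
    Ideal.Quotient.factorₐ _ (truncIdeal_antitone _ n.le_succ)
  -- Both maps yield deformations with the same parameter, the truncated matrix of variables, so
  -- universality identifies them.
  have hcompat : ∀ n, (fac (n + 1)).comp (f (n + 1)) = f n := by
    intro n
    have := finite_quotient_truncIdeal_witt (p := p) (𝔽 := 𝔽) (Fin d × Fin d) (n + 1)
    have hloc := isLocalWittAlgebra_truncResidueMap (p := p) (𝔽 := 𝔽) d n
    have := hloc.isLocalHom
    have h1 := (hfr (n + 1)).map hs.isUnit_card (fac (n + 1))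
    have hπ' : (truncResidueMap p 𝔽 d n).comp ((fac (n + 1)).comp (f (n + 1)) : R →+* _) = π := by
      rw [← hfπ (n + 1)]
      ext x
      obtain ⟨y, hy⟩ := Ideal.Quotient.mk_surjective (f (n + 1) x)
      change truncResidueMap p 𝔽 d n (fac (n + 1) (f (n + 1) x)) =
        truncResidueMap p 𝔽 d (n + 1) (f (n + 1) x)
      rw [← hy]
      rfl
    refine hR.algHom_eq hloc hπ' (hfπ n) ?_
    obtain ⟨k, hk⟩ := hloc.exists_pow_ker_eq_bot
    have h2 : RepHasParam q φ ρ₀ Ψ₀ ((genericMatrix d (WittVector p 𝔽)).map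
        (Ideal.Quotient.mk (wittTruncIdeal p 𝔽 d (n + 1))))
        (mapRep (((fac (n + 1)).comp (f (n + 1)) : R →ₐ[WittVector p 𝔽] _) : R →+* _) r) := h1
    refine h2.rep_eq hφ (hfr n) (isUnit_conjParam hs.isUnit_card (truncResidueMap p 𝔽 d n) ?_)
      (hR.isFramedDeformation.isOpen_ker_mapRep (pow_ker_le_ker_of_comp_eq hπ' hk)) (hfo n)
    exact genericMatrix_map_residueMap (p := p) (𝔽 := 𝔽) d
  -- `f n` lands in truncation `n + 1`; composing with `fac n` gives a system indexed from `0`.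
  obtain ⟨g, hg⟩ := exists_algHom_mk_truncIdeal_eq (fun n => (fac n).comp (f n)) fun n s => by
    have h1 := congrArg (fun k => k s) (hcompat n)
    exact congrArg (fac n) h1
  have hg' : ∀ n s, Ideal.Quotient.mk (wittTruncIdeal p 𝔽 d (n + 1)) (g s) = f n s := fun n s => by
    rw [hg, hcompat]
  have hext : ∀ A B : Matrix (Fin d) (Fin d) (MatrixPowerSeries p 𝔽 d),
      (∀ n, A.map (Ideal.Quotient.mk (wittTruncIdeal p 𝔽 d (n + 1))) =
        B.map (Ideal.Quotient.mk (wittTruncIdeal p 𝔽 d (n + 1)))) → A = B := by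
    intro A B h
    ext1 i j
    rw [← sub_eq_zero]
    refine eq_zero_of_forall_mem_truncIdeal
      (I := RingHom.ker (WittVector.constantCoeff : WittVector p 𝔽 →+* 𝔽)) fun n => ?_
    refine truncIdeal_antitone _ n.le_succ (Ideal.Quotient.eq.mp ?_)
    exact congrFun (congrFun (h n) i) j
  have hmapg : ∀ n x, (mapRep (g : R →+* _) r x).map
      (Ideal.Quotient.mk (wittTruncIdeal p 𝔽 d (n + 1))) = mapRep (f n : R →+* _) r x := by
    intro n x
    ext i j
    exact hg' n _
  -- Triviality on `ker q` and the relations defining the parameter pass to the limit, as they hold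
  -- modulo every truncation ideal.
  obtain ⟨rH, hrH⟩ := exists_monoidHom_factor hq ((mapRep (g : R →+* _) r).comp I.subtype)
    fun i hi => hext _ _ fun n => by
      rw [MonoidHom.comp_apply, hmapg, Matrix.map_one _ (map_zero _) (map_one _)]
      exact (hfr n).eq_one hi
  have hHP := isUnit_card_matrix (d := d) (A := MatrixPowerSeries p 𝔽 d) hs.isUnit_card
  have hρ : ∀ n h, (baseChangeRep ρ₀ (MatrixPowerSeries p 𝔽 d) h).map
      (Ideal.Quotient.mk (wittTruncIdeal p 𝔽 d (n + 1))) = baseChangeRep ρ₀ _ h := fun _ _ => rfl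
  have hY : ∀ n, (conjParam (baseChangeRep ρ₀ (MatrixPowerSeries p 𝔽 d))
      (genericMatrix d (WittVector p 𝔽))).map (Ideal.Quotient.mk (wittTruncIdeal p 𝔽 d (n + 1))) =
      conjParam (baseChangeRep ρ₀ _) ((genericMatrix d (WittVector p 𝔽)).map
        (Ideal.Quotient.mk (wittTruncIdeal p 𝔽 d (n + 1)))) := fun n =>
    map_conjParam (Ideal.Quotient.mk (wittTruncIdeal p 𝔽 d (n + 1))).mapMatrix hHP _ _
  have hF : ∀ n, (frobParam (baseChangeRep ρ₀ (MatrixPowerSeries p 𝔽 d)) (Ψ₀.map (algebraMap _ _))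
      (genericMatrix d (WittVector p 𝔽))).map (Ideal.Quotient.mk (wittTruncIdeal p 𝔽 d (n + 1))) =
      frobParam (baseChangeRep ρ₀ _) (Ψ₀.map (algebraMap _ _)) ((genericMatrix d
        (WittVector p 𝔽)).map (Ideal.Quotient.mk (wittTruncIdeal p 𝔽 d (n + 1)))) := fun n =>
    map_frobParam (Ideal.Quotient.mk (wittTruncIdeal p 𝔽 d (n + 1))).mapMatrix hHP _ _ _
  refine ⟨g, ?_, rH, hrH, fun h => hext _ _ fun n => ?_, hext _ _ fun n => ?_⟩
  · rw [← hfπ 0]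
    ext x
    change _ = truncResidueMap p 𝔽 d 0 (f 0 x)
    rw [← hg']
    rfl
  · obtain ⟨i, rfl⟩ := hq h
    obtain ⟨sH, hsH, h1, -⟩ := hfr n
    rw [Matrix.map_mul, Matrix.map_mul, hY, hρ, hrH, MonoidHom.comp_apply, hmapg, ← h1, hsH]
    rfl
  · obtain ⟨sH, hsH, -, h2⟩ := hfr n
    rw [Matrix.map_mul, Matrix.map_mul, hY, hF, hmapg, h2]

end UniversalParameter

/-! ### Surjectivity and kernel of the parametrisation -/

section QuotientOfUniversalRing

open Matrix MvPowerSeries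

variable {p : ℕ} [Fact p.Prime] {𝔽 : Type u} [Field 𝔽] [Finite 𝔽] [CharP 𝔽 p]

theorem exists_pow_ker_residueMap_le (d n : ℕ) :
    ∃ k, RingHom.ker (residueMap p 𝔽 (Fin d × Fin d)) ^ k ≤ wittTruncIdeal p 𝔽 d (n + 1) := by
  have := finite_quotient_truncIdeal_witt (p := p) (𝔽 := 𝔽) (Fin d × Fin d) (n + 1)
  obtain ⟨k, hk⟩ := (isLocalWittAlgebra_truncResidueMap (p := p) (𝔽 := 𝔽) d n).exists_pow_ker_eq_bot
  refine ⟨k, fun x hx => ?_⟩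
  have hcomp : (truncResidueMap p 𝔽 d n).comp (Ideal.Quotient.mk (wittTruncIdeal p 𝔽 d (n + 1))) =
      residueMap p 𝔽 (Fin d × Fin d) := RingHom.ext fun x => truncResidueMap_mk d n x
  exact Ideal.Quotient.eq_zero_iff_mem.mp (RingHom.mem_ker.mp
    (pow_ker_le_ker_of_comp_eq hcomp hk hx))

/-- The truncations have nilpotent maximal ideals, so every truncation ideal contains a power of
`N`, and the truncation ideals meet in zero. -/
theorem isHausdorff_of_le_ker_residueMap {d : ℕ} {N : Ideal (MatrixPowerSeries p 𝔽 d)}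
    (hN : N ≤ RingHom.ker (residueMap p 𝔽 (Fin d × Fin d))) :
    IsHausdorff N (MatrixPowerSeries p 𝔽 d) := by
  refine ⟨fun x hx => eq_zero_of_forall_mem_truncIdeal
    (I := RingHom.ker (WittVector.constantCoeff : WittVector p 𝔽 →+* 𝔽)) fun n => ?_⟩
  obtain ⟨k, hk⟩ := exists_pow_ker_residueMap_le (p := p) (𝔽 := 𝔽) d n
  have h2 := hx k
  rw [SModEq.zero, smul_eq_mul, Ideal.mul_top] at h2
  exact truncIdeal_antitone _ n.le_succ (hk (Ideal.pow_right_mono hN k h2))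

variable {G : Type*} [Group G] [TopologicalSpace G] [IsTopologicalGroup G]
  {V : Type*} [AddCommGroup V] [Module 𝔽 V] {d : ℕ}
  {ρbar : Representation 𝔽 G V} {β : Module.Basis (Fin d) 𝔽 V}
  {R : Type u} [CommRing R] [Algebra (WittVector p 𝔽) R] {π : R →+* 𝔽}
  {r : G →* Matrix (Fin d) (Fin d) R} {I I' : Subgroup G} {φ : G} {H : Type*} [Group H] [Finite H]
  {q : I →* H} {θ : H →* H} {ρ₀ : H →* Matrix (Fin d) (Fin d) (WittVector p 𝔽)}
  {Ψ₀ : Matrix (Fin d) (Fin d) (WittVector p 𝔽)}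
  {g : R →ₐ[WittVector p 𝔽] MatrixPowerSeries p 𝔽 d}

theorem sub_C_mem_span_X {σ : Type*} [Finite σ] {Λ : Type*} [CommRing Λ] (y : MvPowerSeries σ Λ) :
    y - algebraMap Λ _ (constantCoeff y) ∈
      Ideal.span (Set.range (X : σ → MvPowerSeries σ Λ)) := by
  refine mem_span_X_of_constantCoeff_eq_zero ?_
  simp [MvPowerSeries.algebraMap_apply]

omit [IsTopologicalGroup G] in
/-- The variables are in the ideal generated by the maximal ideal of the universal ring. -/
theorem X_mem_map_ker (hR : IsUniversalFramedDeformation p ρbar β π r)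
    (hs : IsStandardPair q φ θ ρ₀ Ψ₀ WittVector.constantCoeff (matrixRep ρbar β))
    (hq : Function.Surjective q)
    (hgπ : (residueMap p 𝔽 (Fin d × Fin d)).comp (g : R →+* MatrixPowerSeries p 𝔽 d) = π)
    (hg : RepHasParam q φ ρ₀ Ψ₀ (genericMatrix d (WittVector p 𝔽))
      (mapRep (g : R →+* MatrixPowerSeries p 𝔽 d) r)) (ij : Fin d × Fin d) :
    (X ij : MatrixPowerSeries p 𝔽 d) ∈
      (RingHom.ker π).map (g : R →+* MatrixPowerSeries p 𝔽 d) := by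
  set N := (RingHom.ker π).map (g : R →+* MatrixPowerSeries p 𝔽 d) with hN
  have hNle : N ≤ RingHom.ker (residueMap p 𝔽 (Fin d × Fin d)) := by
    rw [hN, Ideal.map_le_iff_le_comap]
    intro x hx
    rw [Ideal.mem_comap, RingHom.mem_ker, ← RingHom.comp_apply, hgπ]
    exact hx
  have hloc := isLocalWittAlgebra_quotient
    (isLocalWittAlgebra_residueMap (p := p) (𝔽 := 𝔽) (Fin d × Fin d)) hNle
  have := hloc.isLocalHom
  have h1 := hg.map hs.isUnit_card (Ideal.Quotient.mkₐ (WittVector p 𝔽) N)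
  -- Modulo `N` an element of `R` is replaced by any Witt vector with the same residue. So the
  -- deformation becomes the constant standard pair, whose parameter is `0`; as the parameter is
  -- unique, the variables vanish modulo `N`.
  have hkey : ∀ (x : R) (w : WittVector p 𝔽), π x = WittVector.constantCoeff w →
      algebraMap (WittVector p 𝔽) (MatrixPowerSeries p 𝔽 d ⧸ N) w =
        Ideal.Quotient.mkₐ (WittVector p 𝔽) N (g x) := by
    intro x w hx
    rw [← AlgHom.commutes (Ideal.Quotient.mkₐ (WittVector p 𝔽) N), ← AlgHom.commutes g,
      Ideal.Quotient.mkₐ_eq_mk, Ideal.Quotient.eq, ← map_sub]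
    refine Ideal.mem_map_of_mem _ ?_
    rw [RingHom.mem_ker, map_sub, hx, sub_eq_zero, ← RingHom.comp_apply,
      hR.isLocalWittAlgebra.comp_eq]
  have h2 : RepHasParam q φ ρ₀ Ψ₀ 0 (mapRep (Ideal.Quotient.mkₐ (WittVector p 𝔽) N :
      MatrixPowerSeries p 𝔽 d →+* MatrixPowerSeries p 𝔽 d ⧸ N)
      (mapRep (g : R →+* MatrixPowerSeries p 𝔽 d) r)) := by
    refine ⟨baseChangeRep ρ₀ _, fun i => ?_, ?_⟩
    · ext j k
      refine hkey _ _ ?_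
      have e1 := congrFun (congrFun (hs.map_rep i) j) k
      have e2 := congrFun (congrFun (hR.isFramedDeformation.reduces i) j) k
      exact e2.trans e1.symm
    · have : mapRep (Ideal.Quotient.mkₐ (WittVector p 𝔽) N :
      MatrixPowerSeries p 𝔽 d →+* MatrixPowerSeries p 𝔽 d ⧸ N)
          (mapRep (g : R →+* MatrixPowerSeries p 𝔽 d) r) φ =
          Ψ₀.map (algebraMap _ (MatrixPowerSeries p 𝔽 d ⧸ N)) := by
        ext j k
        refine (hkey _ _ ?_).symm
        have e1 := congrFun (congrFun hs.map_frob j) k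
        have e2 := congrFun (congrFun (hR.isFramedDeformation.reduces φ) j) k
        exact e2.trans e1.symm
      rw [this]
      exact HasParam.zero _ _
  have h3 := h1.param_eq h2 hq hs (isUnit_conjParam hs.isUnit_card
    (Ideal.Quotient.lift N (residueMap p 𝔽 (Fin d × Fin d)) fun _ ha =>
      RingHom.mem_ker.mp (hNle ha)) (genericMatrix_map_residueMap (p := p) (𝔽 := 𝔽) d))
  exact Ideal.Quotient.eq_zero_iff_mem.mp (congrFun (congrFun h3 ij.1) ij.2)

omit [IsTopologicalGroup G] in
-- A complete form of Nakayama's lemma: `R` is complete, the target is Hausdorff, and modulo the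
-- image of the maximal ideal, which contains the variables, a power series equals its constant
-- term.
theorem surjective_algHom_powerSeries (hR : IsUniversalFramedDeformation p ρbar β π r)
    (hs : IsStandardPair q φ θ ρ₀ Ψ₀ WittVector.constantCoeff (matrixRep ρbar β))
    (hq : Function.Surjective q)
    (hgπ : (residueMap p 𝔽 (Fin d × Fin d)).comp (g : R →+* MatrixPowerSeries p 𝔽 d) = π)
    (hg : RepHasParam q φ ρ₀ Ψ₀ (genericMatrix d (WittVector p 𝔽))
      (mapRep (g : R →+* MatrixPowerSeries p 𝔽 d) r)) : Function.Surjective g := by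
  have := hR.isAdicComplete
  have hN : (RingHom.ker π).map (g : R →+* MatrixPowerSeries p 𝔽 d) ≤
      RingHom.ker (residueMap p 𝔽 (Fin d × Fin d)) := by
    rw [Ideal.map_le_iff_le_comap]
    intro x hx
    rw [Ideal.mem_comap, RingHom.mem_ker, ← RingHom.comp_apply, hgπ]
    exact hx
  have := isHausdorff_of_le_ker_residueMap hN
  refine surjective_of_mk_map_comp_surjective (I := RingHom.ker π)
    (g : R →+* MatrixPowerSeries p 𝔽 d) fun y => ?_
  obtain ⟨y, rfl⟩ := Ideal.Quotient.mk_surjective y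
  refine ⟨algebraMap _ R (constantCoeff y), ?_⟩
  rw [RingHom.comp_apply, eq_comm, Ideal.Quotient.eq]
  have h1 : Ideal.span (Set.range (X : _ → MatrixPowerSeries p 𝔽 d)) ≤
      (RingHom.ker π).map (g : R →+* MatrixPowerSeries p 𝔽 d) := by
    rw [Ideal.span_le]
    rintro _ ⟨ij, rfl⟩
    exact X_mem_map_ker hR hs hq hgπ hg ij
  have h2 := sub_C_mem_span_X y
  rw [← g.commutes] at h2
  exact h1 h2

omit [CharP 𝔽 p] in
/-- The elements killed by the parametrisation are in every ideal modulo which the kernel of `q`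
acts trivially. -/
theorem ker_algHom_powerSeries_le [I.Normal] (hR : IsUniversalFramedDeformation p ρbar β π r)
    (hφ : IsFrobeniusLift I I' φ)
    (hs : IsStandardPair q φ θ ρ₀ Ψ₀ WittVector.constantCoeff (matrixRep ρbar β))
    (hθ : ∀ i : I, q (MulAut.conjNormal φ i) = θ (q i)) (hq : Function.Surjective q)
    (hgπ : (residueMap p 𝔽 (Fin d × Fin d)).comp (g : R →+* MatrixPowerSeries p 𝔽 d) = π)
    (hg : RepHasParam q φ ρ₀ Ψ₀ (genericMatrix d (WittVector p 𝔽))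
      (mapRep (g : R →+* MatrixPowerSeries p 𝔽 d) r)) {J : Ideal R} (hJ : J ≠ ⊤)
    (hJ1 : ∀ i : I, q i = 1 → (r i).map (Ideal.Quotient.mk J) = 1) :
    RingHom.ker g ≤ J := by
  have := hR.isLocalWittAlgebra.isLocalRing
  have := hR.isNoetherianRing
  have hπs := hR.isLocalWittAlgebra.surjective
  have hker := ker_eq_maximalIdeal_of_surjective hπs
  have hJle : J ≤ RingHom.ker π := hker ▸ IsLocalRing.le_maximalIdeal hJ
  have hfin : Finite (R ⧸ RingHom.ker π) :=
    (RingHom.quotientKerEquivOfSurjective hπs).toEquiv.finite_iff.mpr inferInstance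
  intro x hx
  rw [RingHom.mem_ker] at hx
  -- By Krull's intersection theorem on `R ⧸ J`, it suffices to work modulo `K`, where the quotient
  -- is finite and the deformation has a parameter `Z`.
  have hmem : ∀ n : ℕ, x ∈ J ⊔ RingHom.ker π ^ (n + 1) := by
    intro n
    set K := J ⊔ RingHom.ker π ^ (n + 1) with hK
    have hKle : K ≤ RingHom.ker π := sup_le hJle (Ideal.pow_le_self n.succ_ne_zero)
    have := Ideal.finite_quotient_pow (IsNoetherian.noetherian (RingHom.ker π)) (n + 1)
    have : Finite (R ⧸ K) := Finite.of_surjective _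
      (Ideal.Quotient.factor_surjective (le_sup_right : RingHom.ker π ^ (n + 1) ≤ K))
    have hloc := isLocalWittAlgebra_quotient hR.isLocalWittAlgebra hKle
    have := hloc.isLocalHom
    obtain ⟨k, hk⟩ := hloc.exists_pow_ker_eq_bot
    set πA := Ideal.Quotient.lift K π fun _ ha => RingHom.mem_ker.mp (hKle ha) with hπA
    have hmkπ : πA.comp (Ideal.Quotient.mkₐ (WittVector p 𝔽) K : R →+* R ⧸ K) = π := rfl
    obtain ⟨Z, hZ, hZr⟩ := exists_repHasParam hs hq hθ (π := πA) hloc.comp_eq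
      (r := mapRep (Ideal.Quotient.mkₐ (WittVector p 𝔽) K : R →+* R ⧸ K) r)
      (fun x => hR.isFramedDeformation.reduces x) (fun i hi => by
        have h1 := congrArg (fun M => M.map (Ideal.Quotient.factor (le_sup_left : J ≤ K)))
          (hJ1 i hi)
        rw [Matrix.map_one _ (map_zero _) (map_one _)] at h1
        exact h1)
    have hnil : ∀ a, πA a = 0 → IsNilpotent a := fun a ha => ⟨k, by
      have := Ideal.pow_mem_pow (RingHom.mem_ker.mpr ha) k
      rwa [hk] at this⟩
    obtain ⟨h, hh⟩ := exists_algHom_X_eq (Λ := WittVector p 𝔽) (fun ij : Fin d × Fin d => Z ij.1 ij.2)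
      fun ij => hnil _ (congrFun (congrFun hZ ij.1) ij.2)
    have hgen : (genericMatrix d (WittVector p 𝔽)).map h = Z := by
      ext i j
      exact hh (i, j)
    have hπh : πA.comp (h : MatrixPowerSeries p 𝔽 d →+* R ⧸ K) = residueMap p 𝔽 (Fin d × Fin d) := by
      ext y
      have h1 : Ideal.span (Set.range (X : _ → MatrixPowerSeries p 𝔽 d)) ≤
          RingHom.ker (πA.comp (h : MatrixPowerSeries p 𝔽 d →+* R ⧸ K)) := by
        rw [Ideal.span_le]
        rintro _ ⟨ij, rfl⟩
        rw [SetLike.mem_coe, RingHom.mem_ker, RingHom.comp_apply]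
        exact (congrArg πA (hh ij)).trans (congrFun (congrFun hZ ij.1) ij.2)
      have h2 := RingHom.mem_ker.mp (h1 (sub_C_mem_span_X y))
      rw [map_sub, sub_eq_zero] at h2
      rw [h2, RingHom.comp_apply]
      change πA (h (algebraMap _ _ _)) = _
      rw [h.commutes, ← RingHom.comp_apply, hloc.comp_eq]
      rfl
    have hcomp : πA.comp ((h.comp g : R →ₐ[WittVector p 𝔽] R ⧸ K) : R →+* R ⧸ K) = π := by
      rw [← hgπ, ← hπh]
      rfl
    have hparam := hg.map hs.isUnit_card h
    rw [hgen] at hparam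
    -- Specialising the variables to `Z` yields the deformation over `R ⧸ K`; by universality the
    -- quotient map factors through `g`.
    have heq : h.comp g = Ideal.Quotient.mkₐ (WittVector p 𝔽) K := by
      refine hR.algHom_eq hloc hcomp hmkπ ?_
      exact hparam.rep_eq hφ hZr (isUnit_conjParam hs.isUnit_card πA hZ)
        (hR.isFramedDeformation.isOpen_ker_mapRep (pow_ker_le_ker_of_comp_eq hcomp hk))
        (hR.isFramedDeformation.isOpen_ker_mapRep (pow_ker_le_ker_of_comp_eq hmkπ hk))
    have h3 := congrArg (fun f => f x) heq
    simp only [AlgHom.comp_apply, hx, map_zero] at h3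
    exact Ideal.Quotient.eq_zero_iff_mem.mp h3.symm
  have hh : IsHausdorff (IsLocalRing.maximalIdeal R) (R ⧸ J) := inferInstance
  rw [← Ideal.Quotient.eq_zero_iff_mem]
  refine hh.haus _ fun n => ?_
  rw [SModEq.zero]
  obtain ⟨a, ha, b, hb, hab⟩ := Submodule.mem_sup.mp (hmem n)
  rw [← hab, map_add, Ideal.Quotient.eq_zero_iff_mem.mpr ha, zero_add]
  have h1 : Ideal.Quotient.mk J b = b • (1 : R ⧸ J) := by
    rw [Algebra.smul_def, mul_one]; rfl
  rw [h1]
  rw [hker] at hb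
  exact Submodule.smul_mem_smul (Ideal.pow_le_pow_right n.le_succ hb) Submodule.mem_top

end QuotientOfUniversalRing

/-! ### Vanishing of monodromy in characteristic zero -/

section MonodromyVanishing

open Matrix

/-- If the least `m` with `X ^ m = 0` were at least `2`, multiplying by `X ^ (m - 2)` would leave `X
^ (m - 2) + X ^ (m - 1) = X ^ (m - 2)`, against minimality. -/
theorem eq_zero_of_sum_inv_factorial_eq_one {Q : Type*} [Field Q] [CharZero Q] {E : Type*} [Ring E]
    [Algebra Q E] {X : E} {n : ℕ} (hn : X ^ n = 0)
    (h : ∑ k ∈ Finset.range n, (k.factorial : Q)⁻¹ • X ^ k = 1) : X = 0 := by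
  by_contra hX
  have hex : ∃ m, X ^ m = 0 := ⟨n, hn⟩
  classical
  obtain ⟨m, hm, hmin⟩ : ∃ m, X ^ m = 0 ∧ ∀ k < m, X ^ k ≠ 0 :=
    ⟨Nat.find hex, Nat.find_spec hex, fun k hk => Nat.find_min hex hk⟩
  have hm0 : m ≠ 0 := by
    rintro rfl
    rw [pow_zero] at hm
    exact hX (by rw [← mul_one X, hm, mul_zero])
  have hm1 : m ≠ 1 := by
    rintro rfl
    exact hX (by simpa using hm)
  obtain ⟨m, rfl⟩ : ∃ j, m = j + 2 := ⟨m - 2, by omega⟩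
  have hnm : m + 2 ≤ n := by
    by_contra hlt
    exact hmin n (by omega) hn
  obtain ⟨n, rfl⟩ : ∃ j, n = j + 2 := ⟨n - 2, by omega⟩
  have h1 := congrArg (fun Y => X ^ m * Y) h
  simp only [Finset.mul_sum, mul_one] at h1
  rw [Finset.sum_range_succ', Finset.sum_range_succ', Finset.sum_eq_zero] at h1
  · simp only [zero_add, Nat.factorial_one, Nat.cast_one, inv_one, one_smul, pow_one,
      Nat.factorial_zero, pow_zero, mul_one, add_eq_right, ← pow_succ] at h1
    exact hmin _ (by omega) h1
  · intro k _
    rw [mul_smul_comm, ← pow_add, show m + (k + 1 + 1) = m + 2 + k by omega, pow_add, hm, zero_mul,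
      smul_zero]

theorem exists_pow_mul_coprime {p : ℕ} (hp : p.Prime) {n : ℕ} (hn : n ≠ 0) :
    ∃ a b, n = p ^ a * b ∧ b.Coprime p := by
  obtain ⟨a, b, hb, rfl⟩ := Nat.exists_eq_pow_mul_and_not_dvd hn p hp.ne_one
  exact ⟨a, b, rfl, ((Nat.Prime.coprime_iff_not_dvd hp).mpr hb).symm⟩

theorem natCast_ne_zero_of_coprime {p : ℕ} [Fact p.Prime] {F : Type*} [Field F] [CharP F p] {b : ℕ}
    (hb : b.Coprime p) : (b : F) ≠ 0 := by
  rw [Ne, CharP.cast_eq_zero_iff F p]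
  exact (Nat.Prime.coprime_iff_not_dvd Fact.out).mp hb.symm

/-- The prime-to-`p` part of an integer survives in the residue field, and the power of `p` is
nonzero because `D` is a domain. -/
theorem charZero_of_residue {p : ℕ} [Fact p.Prime] {D F : Type*} [CommRing D] [IsDomain D] [Field F]
    [CharP F p] (π : D →+* F) (hp : (p : D) ≠ 0) : CharZero D := by
  refine charZero_of_inj_zero fun n hn => ?_
  by_contra hne
  obtain ⟨a, b, rfl, hb⟩ := exists_pow_mul_coprime (Fact.out : p.Prime) hne
  push_cast at hn
  rcases mul_eq_zero.mp hn with h | h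
  · exact hp (eq_zero_of_pow_eq_zero h)
  · exact natCast_ne_zero_of_coprime (F := F) hb (by simpa using congrArg π h)

/-- A homomorphism from the `p`-adic integers to a domain of characteristic zero is injective. -/
theorem padicInt_ringHom_injective {p : ℕ} [Fact p.Prime] {D : Type*} [CommRing D] [IsDomain D]
    [CharZero D] (f : ℤ_[p] →+* D) : Function.Injective f := by
  rw [injective_iff_map_eq_zero]
  intro x hx
  by_contra hne
  rw [PadicInt.unitCoeff_spec hne, map_mul, map_pow, map_natCast] at hx
  have hp : (p : D) ≠ 0 := Nat.cast_ne_zero.mpr (Fact.out : p.Prime).ne_zero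
  exact mul_ne_zero ((PadicInt.unitCoeff hne).isUnit.map f).ne_zero (pow_ne_zero _ hp) hx

theorem isUnit_natCast_away {p : ℕ} [Fact p.Prime] {R : Type*} [CommRing R]
    (hR : ∀ b : ℕ, b.Coprime p → IsUnit (b : R)) {n : ℕ} (hn : n ≠ 0) :
    IsUnit (n : Localization.Away (p : R)) := by
  obtain ⟨a, b, rfl, hb⟩ := exists_pow_mul_coprime (Fact.out : p.Prime) hn
  have h1 := IsLocalization.Away.algebraMap_isUnit (S := Localization.Away (p : R)) (p : R)
  have h2 := (hR b hb).map (algebraMap R (Localization.Away (p : R)))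
  push_cast
  simp only [map_natCast] at h1 h2
  exact (h1.pow a).mul h2

/-- The range of summation stays that of `X`, although its image may have a smaller nilpotency
class. -/
theorem map_nilExp {A Q : Type*} [CommRing A] [Field Q] {d : ℕ}
    (hA : ∀ n : ℕ, n ≠ 0 → IsUnit (n : A)) (f : A →+* Q) (X : Matrix (Fin d) (Fin d) A) :
    (nilExp X).map f = ∑ k ∈ Finset.range (nilpotencyClass X),
      (k.factorial : Q)⁻¹ • (X.map f) ^ k := by
  rw [nilExp, ← RingHom.mapMatrix_apply, map_sum]
  refine Finset.sum_congr rfl fun k _ => ?_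
  have h1 : f.mapMatrix (Ring.inverse (k.factorial : A) • X ^ k) =
      f (Ring.inverse (k.factorial : A)) • f.mapMatrix (X ^ k) := by
    ext i j
    simp
  rw [h1, map_pow, map_ringInverse f (hA _ (Nat.factorial_ne_zero k)), map_natCast, Ring.inverse_eq_inv']
  rfl

/-- The locus of vanishing monodromy contains the image of every homomorphism to a domain of
characteristic zero under which the inertia elements of some nonzero tame parameter act
trivially. -/
theorem le_ker_of_cutsOutVanishing {p : ℕ} [Fact p.Prime] {𝔽 : Type u} [Field 𝔽] [CharP 𝔽 p]
    {G : Type*} [Group G] [TopologicalSpace G] {I : Subgroup G} {t : I →* Multiplicative ℤ_[p]}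
    {R : Type u} [CommRing R] [Algebra (WittVector p 𝔽) R] {d : ℕ}
    {r : G →* Matrix (Fin d) (Fin d) R} {N : Matrix (Fin d) (Fin d) (Localization.Away (p : R))}
    (hN : IsMonodromyOperator p 𝔽 t r N) {J : Ideal R} (hJ : CutsOutVanishing p N J)
    (hR : ∀ b : ℕ, b.Coprime p → IsUnit (b : R)) {D : Type*} [CommRing D] [IsDomain D] [CharZero D]
    (g : R →+* D) (hg : ∀ U : Subgroup G, IsOpen (U : Set G) →
      ∃ σ : I, (σ : G) ∈ U ∧ t σ ≠ 1 ∧ (r σ).map g = 1) : J ≤ RingHom.ker g := by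
  set Q := FractionRing D
  set gQ : R →+* Q := (algebraMap D Q).comp g with hgQ
  have : CharZero Q := charZero_of_injective_algebraMap (IsFractionRing.injective D Q)
  have hpQ : IsUnit (gQ (p : R)) := by
    rw [map_natCast, isUnit_iff_ne_zero]
    exact Nat.cast_ne_zero.mpr (Fact.out : p.Prime).ne_zero
  set f : Localization.Away (p : R) →+* Q := IsLocalization.Away.lift (p : R) hpQ with hf
  have hfa : ∀ x, f (algebraMap R _ x) = gQ x := IsLocalization.Away.lift_eq (p : R) hpQ
  obtain ⟨U, hU, hexp⟩ := hN.eq_exp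
  obtain ⟨σ, hσU, htσ, hσ⟩ := hg U hU
  set τ := padicToAlg p 𝔽 R (Multiplicative.toAdd (t σ)) with hτ
  -- `ℤ_p` embeds in the fraction field, so `t σ` acts as a nonzero scalar and can be cancelled from
  -- `τ N = 0` below.
  have hτ0 : gQ τ ≠ 0 := fun h0 => htσ <| by
    have h1 : (gQ.comp (padicToAlg p 𝔽 R)) (Multiplicative.toAdd (t σ)) = 0 := h0
    have h2 := padicInt_ringHom_injective (gQ.comp (padicToAlg p 𝔽 R)) (h1.trans (map_zero _).symm)
    exact Multiplicative.toAdd.injective h2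
  have h1 := congrArg (fun M => M.map f) (hexp σ hσU)
  beta_reduce at h1
  rw [map_nilExp (fun n hn => isUnit_natCast_away hR hn) f] at h1
  have h2 : ((r σ).map (algebraMap R (Localization.Away (p : R)))).map f = 1 := by
    have : ((r σ).map (algebraMap R (Localization.Away (p : R)))).map f =
        ((r σ).map g).map (algebraMap D Q) := by
      ext i j
      exact hfa _
    rw [this, hσ, Matrix.map_one _ (map_zero _) (map_one _)]
  rw [h2] at h1
  have hnil : IsNilpotent (algebraMap R (Localization.Away (p : R)) τ • N) := hN.isNilpotent.smul _
  have h3 := eq_zero_of_sum_inv_factorial_eq_one (n := nilpotencyClass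
    (algebraMap R (Localization.Away (p : R)) τ • N)) (by
      rw [← RingHom.mapMatrix_apply, ← map_pow, pow_nilpotencyClass hnil, map_zero]) h1.symm
  have hNf : ∀ i j, f (N i j) = 0 := fun i j => by
    have h4 := congrFun (congrFun h3 i) j
    simp only [Matrix.map_apply, Matrix.smul_apply, smul_eq_mul, map_mul, hfa, Matrix.zero_apply,
      mul_eq_zero] at h4
    exact h4.resolve_left hτ0
  have hle : J.map (algebraMap R (Localization.Away (p : R))) ≤ RingHom.ker f := by
    rw [show J.map _ = _ from hJ, Ideal.span_le]
    rintro _ ⟨ij, rfl⟩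
    exact hNf _ _
  intro x hx
  have h5 := RingHom.mem_ker.mp (hle (Ideal.mem_map_of_mem _ hx))
  rw [hfa] at h5
  exact (IsFractionRing.injective D Q) (h5.trans (map_zero _).symm)

end MonodromyVanishing

/-! ### Smoothness for a profinite group with a Frobenius lift -/

section AbstractSmoothness

open Matrix

/-- Open subgroups of a compact group have finite index. If `t` were trivial on `U ∩ I'`, its kernel
would have finite index in `I`, and `ℤ_p` would be finite. -/
theorem exists_mem_of_surjective_padicInt {p : ℕ} [Fact p.Prime] {G : Type*} [Group G]
    [TopologicalSpace G] [IsTopologicalGroup G] [CompactSpace G] {I I' : Subgroup G}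
    [(I'.subgroupOf I).FiniteIndex] {t : I →* Multiplicative ℤ_[p]} (ht : Function.Surjective t)
    (U : Subgroup G) (hU : IsOpen (U : Set G)) :
    ∃ σ : I, (σ : G) ∈ U ∧ (σ : G) ∈ I' ∧ t σ ≠ 1 := by
  by_contra! h
  have : Finite (G ⧸ U) := U.quotient_finite_of_isOpen hU
  have : U.FiniteIndex := Subgroup.finiteIndex_of_finite_quotient
  have hle : U.subgroupOf I ⊓ I'.subgroupOf I ≤ t.ker := fun σ hσ => h σ hσ.1 hσ.2
  have : t.ker.FiniteIndex := Subgroup.finiteIndex_of_le hle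
  have hfin : Finite (I ⧸ t.ker) := inferInstance
  have : Finite (Multiplicative ℤ_[p]) :=
    (QuotientGroup.quotientKerEquivOfSurjective t ht).toEquiv.finite_iff.mp hfin
  have hinf : Infinite ℤ_[p] := inferInstance
  exact hinf.not_finite ‹_›

theorem map_quotient_mk_eq_one {R F : Type*} [CommRing R] [CommRing F] {d : ℕ} {J : Ideal R}
    {π : R →+* F} (hJ : J ≤ RingHom.ker π) {M : Matrix (Fin d) (Fin d) R}
    (hM : M.map (Ideal.Quotient.mk J) = 1) : M.map π = 1 := by
  have h1 : M.map π = (M.map (Ideal.Quotient.mk J)).map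
    (Ideal.Quotient.lift J π fun _ ha => RingHom.mem_ker.mp (hJ ha)) := rfl
  rw [h1, hM, Matrix.map_one _ (map_zero _) (map_one _)]

variable {p : ℕ} [Fact p.Prime] {𝔽 : Type u} [Field 𝔽] [Finite 𝔽] [CharP 𝔽 p]

instance isDomain_mvPowerSeries_witt (σ : Type*) : IsDomain (MvPowerSeries σ (WittVector p 𝔽)) :=
  NoZeroDivisors.to_isDomain _

omit [Finite 𝔽] in
theorem charZero_mvPowerSeries_witt (σ : Type*) : CharZero (MvPowerSeries σ (WittVector p 𝔽)) := by
  refine charZero_of_residue (residueMap p 𝔽 σ) fun h => WittVector.p_nonzero p 𝔽 ?_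
  have h1 := congrArg MvPowerSeries.constantCoeff h
  rwa [map_natCast, map_zero] at h1

omit [Finite 𝔽] [CharP 𝔽 p] in
/-- A power series ring in the entries of a matrix is a power series ring in a finite number of
variables. -/
theorem isFormallySmoothOfRelDim_matrixPowerSeries (d : ℕ) :
    IsFormallySmoothOfRelDim p 𝔽 (MatrixPowerSeries p 𝔽 d) (d ^ 2) :=
  ⟨MvPowerSeries.renameEquiv (R := WittVector p 𝔽) (finProdFinEquiv.trans (finCongr (sq d).symm))⟩

variable {G : Type*} [Group G] [TopologicalSpace G] [IsTopologicalGroup G] [CompactSpace G]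
  {V : Type*} [AddCommGroup V] [Module 𝔽 V] {d : ℕ}
  {ρbar : Representation 𝔽 G V} {β : Module.Basis (Fin d) 𝔽 V}
  {R : Type u} [CommRing R] [Algebra (WittVector p 𝔽) R] {π : R →+* 𝔽}
  {r : G →* Matrix (Fin d) (Fin d) R} {I I' : Subgroup G} {φ : G}

/-- The locus of vanishing monodromy is formally smooth if it is trivial on a subgroup of inertia
of finite index prime to `p`. -/
theorem isFormallySmoothOfRelDim_of_isFrobeniusLift (hφ : IsFrobeniusLift I I' φ)
    [(I'.subgroupOf I).FiniteIndex] (hcop : (I'.subgroupOf I).index.Coprime p)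
    (hR : IsUniversalFramedDeformation p ρbar β π r) {t : I →* Multiplicative ℤ_[p]}
    (ht : Function.Surjective t) {N : Matrix (Fin d) (Fin d) (Localization.Away (p : R))}
    (hN : IsMonodromyOperator p 𝔽 t r N) {J : Ideal R} (hJ : CutsOutVanishing p N J) (hJ_ne : J ≠ ⊤)
    (hI' : ∀ σ ∈ I', (r σ).map (Ideal.Quotient.mk J) = 1) :
    IsFormallySmoothOfRelDim p 𝔽 (R ⧸ J) (d ^ 2) := by
  have := hφ.normal
  have := hφ.normal'
  have := hR.isLocalWittAlgebra.isLocalRing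
  have hπs := hR.isLocalWittAlgebra.surjective
  have hJle : J ≤ RingHom.ker π :=
    ker_eq_maximalIdeal_of_surjective hπs ▸ IsLocalRing.le_maximalIdeal hJ_ne
  let q : I →* I ⧸ I'.subgroupOf I := QuotientGroup.mk' _
  have hq : Function.Surjective q := QuotientGroup.mk'_surjective _
  have hq1 : ∀ i : I, q i = 1 ↔ (i : G) ∈ I' := fun i => QuotientGroup.eq_one_iff i
  let θ : I ⧸ I'.subgroupOf I →* I ⧸ I'.subgroupOf I :=
    QuotientGroup.map _ _ (MulAut.conjNormal φ : I ≃* I).toMonoidHom fun i hi =>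
      hφ.normal'.conj_mem i hi φ
  have hθ : ∀ i : I, q (MulAut.conjNormal φ i) = θ (q i) := fun _ => rfl
  have hres : ∀ b : ℕ, b.Coprime p → (b : 𝔽) ≠ 0 := fun b => natCast_ne_zero_of_coprime
  have hH : IsUnit (Nat.card (I ⧸ I'.subgroupOf I) : WittVector p 𝔽) := by
    refine isUnit_of_map_unit (WittVector.constantCoeff : WittVector p 𝔽 →+* 𝔽) _ ?_
    rw [map_natCast]
    exact (hres _ hcop).isUnit
  have hRunit : ∀ b : ℕ, b.Coprime p → IsUnit (b : R) := fun b hb => by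
    have := hR.isLocalWittAlgebra.isLocalHom
    refine isUnit_of_map_unit π _ ?_
    rw [map_natCast]
    exact (hres _ hb).isUnit
  obtain ⟨ρ₀, Ψ₀, hs⟩ := exists_isStandardPair (c := (WittVector.constantCoeff : WittVector p 𝔽 →+* 𝔽))
    (ρF := matrixRep ρbar β) (WittVector.constantCoeff_surjective p) hq hθ hH fun i hi =>
      (hR.isFramedDeformation.reduces i).symm.trans
        (map_quotient_mk_eq_one hJle (hI' i ((hq1 i).mp hi)))
  obtain ⟨g, hgπ, hg⟩ := hR.exists_algHom_powerSeries hφ (fun i hi => (hq1 i).mpr hi) hs hθ hq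
  have hgs := surjective_algHom_powerSeries hR hs hq hgπ hg
  have hle := ker_algHom_powerSeries_le hR hφ hs hθ hq hgπ hg hJ_ne fun i hi =>
    hI' i ((hq1 i).mp hi)
  have := charZero_mvPowerSeries_witt (p := p) (𝔽 := 𝔽) (Fin d × Fin d)
  have hge : J ≤ RingHom.ker (g : R →+* MatrixPowerSeries p 𝔽 d) :=
    le_ker_of_cutsOutVanishing hN hJ hRunit _ fun U hU => by
      obtain ⟨σ, hσU, hσ, htσ⟩ := exists_mem_of_surjective_padicInt (I' := I') ht U hU
      exact ⟨σ, hσU, htσ, hg.eq_one ((hq1 σ).mpr hσ)⟩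
  obtain rfl : J = RingHom.ker g := le_antisymm hge hle
  exact ⟨(Ideal.quotientKerAlgEquivOfSurjective hgs).trans
    (isFormallySmoothOfRelDim_matrixPowerSeries d).some⟩

end AbstractSmoothness

/-! ### Existence of Frobenius lifts -/

section FrobeniusLifts

open Pointwise

/-- The gcd of `Q ^ m - 1` and `Q ^ k - 1` is `Q ^ gcd(m, k) - 1`. -/
theorem dvd_of_pow_sub_one_dvd {Q m k : ℕ} (hQ : 1 < Q) (h : Q ^ m - 1 ∣ Q ^ k - 1) : m ∣ k := by
  have h1 := Nat.gcd_eq_left h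
  rw [Nat.pow_sub_one_gcd_pow_sub_one] at h1
  have h2 : 1 ≤ Q ^ m := Nat.one_le_pow _ _ (by omega)
  have h3 : 1 ≤ Q ^ m.gcd k := Nat.one_le_pow _ _ (by omega)
  have h4 : m.gcd k = m := Nat.pow_right_injective hQ (show Q ^ _ = Q ^ _ by omega)
  exact Nat.gcd_eq_left_iff_dvd.mp h4

variable {k E : Type*} [Field k] [Field E] [Algebra k E]

/-- An automorphism of a finite extension of a finite field is a power of Frobenius. -/
theorem exists_pow_eq_of_finiteGalois [Fintype k] [IsGalois k E] {Φ : Gal(E/k)}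
    (hΦ : ∀ x, Φ x = x ^ Fintype.card k) (F : FiniteGaloisIntermediateField k E) (g : Gal(E/k)) :
    ∃ n : ℕ, ∀ x ∈ F.toIntermediateField, (Φ ^ n) x = g x := by
  have : Finite F := Module.finite_of_finite k
  obtain ⟨n, hn⟩ := (FiniteField.bijective_frobeniusAlgEquivOfAlgebraic_pow k F).2
    (AlgEquiv.restrictNormalHom F g)
  have hpow : ∀ (n : ℕ) x, (Φ ^ n) x = x ^ Fintype.card k ^ n := by
    intro n
    induction n with
    | zero => intro x; simp
    | succ n ih => intro x; rw [pow_succ', AlgEquiv.mul_apply, hΦ, ih, ← pow_mul, pow_succ]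
  refine ⟨n, fun x hx => ?_⟩
  have h1 : (FiniteField.frobeniusAlgEquivOfAlgebraic k F ^ (n : ℕ)) ⟨x, hx⟩ =
    AlgEquiv.restrictNormalHom F g ⟨x, hx⟩ := DFunLike.congr_fun hn _
  rw [AlgEquiv.coe_pow, FiniteField.coe_frobeniusAlgEquivOfAlgebraic_iterate] at h1
  have h2 := AlgEquiv.restrictNormal_commutes g F ⟨x, hx⟩
  rw [hpow]
  exact (congrArg Subtype.val h1).trans h2

variable {G : Type*} [Group G] [TopologicalSpace G] [IsTopologicalGroup G] [CompactSpace G]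
  {Θ : G →* Gal(E/k)}

omit [CompactSpace G] in
theorem isOpen_setOf_apply_eq {x : E} {U : Subgroup G} (hU : IsOpen (U : Set G))
    (h : ∀ g ∈ U, Θ g x = x) (y : E) : IsOpen {g : G | Θ g x = y} := by
  refine isOpen_iff_mem_nhds.mpr fun g hg => ?_
  refine Filter.mem_of_superset ((hU.leftCoset g).mem_nhds ⟨1, U.one_mem, mul_one g⟩) ?_
  rintro _ ⟨u, hu, rfl⟩
  simpa [h u hu] using hg

omit [CompactSpace G] in
theorem isClosed_setOf_apply_eq {x : E} {U : Subgroup G} (hU : IsOpen (U : Set G))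
    (h : ∀ g ∈ U, Θ g x = x) (y : E) : IsClosed {g : G | Θ g x = y} := by
  rw [← isOpen_compl_iff]
  have : {g : G | Θ g x = y}ᶜ = ⋃ z ∈ ({y}ᶜ : Set E), {g : G | Θ g x = z} := by
    ext g
    simp
  rw [this]
  exact isOpen_biUnion fun z _ => isOpen_setOf_apply_eq hU h z

omit [CompactSpace G] in
-- The set is the union of the `g U φ⁻ⁿ`, so it and its complement are stable under left
-- multiplication by the open subgroup `g U g⁻¹`.
theorem isClosed_setOf_eq_mul_zpow_mul {U : Subgroup G} (hU : IsOpen (U : Set G)) (φ g : G) :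
    IsClosed {h : G | ∃ n : ℤ, ∃ u ∈ U, g = h * φ ^ n * u} := by
  rw [← isOpen_compl_iff]
  refine isOpen_iff_mem_nhds.mpr fun h hh => ?_
  have hcont : Continuous fun x : G => g⁻¹ * h * x⁻¹ * g := by fun_prop
  refine Filter.mem_of_superset ((hU.preimage hcont).mem_nhds (by simp)) ?_
  rintro x hx ⟨n, u, hu, hg⟩
  refine hh ⟨n, u * (g⁻¹ * h * x⁻¹ * g)⁻¹, U.mul_mem hu (U.inv_mem hx), ?_⟩
  have h1 : u = φ ^ (-n) * x⁻¹ * g := by rw [hg]; group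
  rw [h1]
  group

/-- A compactness argument. On each finite Galois layer some `g φ ^ n` acts trivially, as Frobenius
generates the Galois group of the layer. The resulting closed sets are directed, and a common point
lies in `ker Θ`. -/
theorem exists_eq_mem_ker_mul_zpow_mul [Fintype k] [IsGalois k E]
    (hΘ : ∀ x, ∃ U : Subgroup G, IsOpen (U : Set G) ∧ ∀ g ∈ U, Θ g x = x) {φ : G}
    (hφ : ∀ x, Θ φ x = x ^ Fintype.card k) (U : Subgroup G) (hU : IsOpen (U : Set G)) (g : G) :
    ∃ i ∈ Θ.ker, ∃ n : ℤ, ∃ u ∈ U, g = i * φ ^ n * u := by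
  let S : Set G := {h : G | ∃ n : ℤ, ∃ u ∈ U, g = h * φ ^ n * u}
  let T : FiniteGaloisIntermediateField k E → Set G := fun F => S ∩ ⋂ x ∈ F.toIntermediateField, {h : G | Θ h x = x}
  have hclosed : ∀ F, IsClosed (T F) := fun F =>
    (isClosed_setOf_eq_mul_zpow_mul hU φ g).inter <| isClosed_biInter fun x _ => by
      obtain ⟨V, hV, hx⟩ := hΘ x
      exact isClosed_setOf_apply_eq hV hx x
  have hne : ∀ F, (T F).Nonempty := fun F => by
    obtain ⟨n, hn⟩ := exists_pow_eq_of_finiteGalois hφ F (Θ g⁻¹)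
    have h1 : ∀ x ∈ F.toIntermediateField, Θ (g * φ ^ n) x = x := fun x hx => by
      rw [map_mul, AlgEquiv.mul_apply, map_pow, hn x hx, ← AlgEquiv.mul_apply, ← map_mul,
        mul_inv_cancel, map_one, AlgEquiv.one_apply]
    refine ⟨g * φ ^ n, ⟨-n, 1, U.one_mem, by group⟩, ?_⟩
    simp only [Set.mem_iInter]
    exact h1
  have hdir : Directed (· ⊇ ·) T := fun F F' => ⟨F ⊔ F', by
    constructor <;> refine Set.inter_subset_inter_right _ (Set.biInter_mono ?_ fun _ _ => subset_rfl)
    · exact fun x hx => (le_sup_left : F ≤ F ⊔ F') hx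
    · exact fun x hx => (le_sup_right : F' ≤ F ⊔ F') hx⟩
  obtain ⟨i, hi⟩ := IsCompact.nonempty_iInter_of_directed_nonempty_isCompact_isClosed T hdir hne
    (fun F => (hclosed F).isCompact) hclosed
  rw [Set.mem_iInter] at hi
  refine ⟨i, ?_, (hi ⊥).1⟩
  rw [MonoidHom.mem_ker]
  ext x
  have h1 := (hi (FiniteGaloisIntermediateField.adjoin k {x})).2
  simp only [Set.mem_iInter] at h1
  exact h1 x (FiniteGaloisIntermediateField.subset_adjoin k {x} rfl)

/-- For `n ≥ 0`, if `Φ ^ n` fixes `ζ`, then the order `Q ^ m - 1` of `ζ` divides `Q ^ n - 1`, where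
`Q` is the cardinality of `k`; negative `n` reduces to this by inversion. -/
theorem dvd_of_zpow_apply_eq [Fintype k] {Φ : Gal(E/k)} (hΦ : ∀ x, Φ x = x ^ Fintype.card k) {m : ℕ}
    (hm : m ≠ 0) {ζ : E} (hζ : IsPrimitiveRoot ζ (Fintype.card k ^ m - 1)) {n : ℤ} (hn : (Φ ^ n) ζ = ζ) :
    (m : ℤ) ∣ n := by
  have hpow : ∀ (n : ℕ) x, (Φ ^ n) x = x ^ Fintype.card k ^ n := by
    intro n
    induction n with
    | zero => intro x; simp
    | succ n ih => intro x; rw [pow_succ', AlgEquiv.mul_apply, hΦ, ih, ← pow_mul, pow_succ]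
  have hQ : 1 < Fintype.card k := Fintype.one_lt_card
  have key : ∀ n : ℕ, (Φ ^ n) ζ = ζ → m ∣ n := fun n hn => by
    refine dvd_of_pow_sub_one_dvd hQ (hζ.dvd_of_pow_eq_one _ ?_)
    rw [hpow] at hn
    have hζ0 : ζ ≠ 0 := hζ.ne_zero (Nat.sub_ne_zero_of_lt (Nat.one_lt_pow hm hQ))
    refine mul_right_cancel₀ hζ0 ?_
    rw [← pow_succ, one_mul, Nat.sub_add_cancel (Nat.one_le_pow _ _ (by omega)), hn]
  obtain ⟨n, rfl | rfl⟩ := n.eq_nat_or_neg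
  · exact Int.natCast_dvd_natCast.mpr (key n (by simpa using hn))
  · refine (dvd_neg).mpr (Int.natCast_dvd_natCast.mpr (key n ?_))
    rw [zpow_neg, zpow_natCast] at hn
    nth_rewrite 1 [← hn]
    rw [← AlgEquiv.mul_apply, mul_inv_cancel, AlgEquiv.one_apply]

theorem exists_isPrimitiveRoot_card_pow_sub_one [Fintype k] [IsAlgClosed E] {m : ℕ} (hm : m ≠ 0) :
    ∃ ζ : E, IsPrimitiveRoot ζ (Fintype.card k ^ m - 1) := by
  have hne : ((Fintype.card k ^ m - 1 : ℕ) : E) ≠ 0 := by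
    rw [Nat.cast_sub (Nat.one_le_pow _ _ Fintype.card_pos)]
    have h1 : (Fintype.card k : E) = 0 := by
      rw [← map_natCast (algebraMap k E), FiniteField.cast_card_eq_zero, map_zero]
    simp [h1, hm]
  have : NeZero ((Fintype.card k ^ m - 1 : ℕ) : E) := ⟨hne⟩
  exact HasEnoughRootsOfUnity.exists_primitiveRoot E _

/-- A continuous surjection from a profinite group to the absolute Galois group of a finite field
has a Frobenius lift. -/
theorem exists_isFrobeniusLift_of_surjective [Finite k] [IsAlgClosed E] [Algebra.IsAlgebraic k E]
    (hΘ : ∀ x, ∃ U : Subgroup G, IsOpen (U : Set G) ∧ ∀ g ∈ U, Θ g x = x)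
    (hsurj : Function.Surjective Θ) (N : Subgroup G) [hN : N.Normal] (hNo : IsOpen (N : Set G)) :
    ∃ φ, IsFrobeniusLift Θ.ker (Θ.ker ⊓ N) φ := by
  have := Fintype.ofFinite k
  have : IsAlgClosure k E := ⟨‹_›, ‹_›⟩
  have : Normal k E := IsAlgClosure.normal k E
  have : IsGalois k E := {}
  obtain ⟨φ, hφ'⟩ := hsurj (FiniteField.frobeniusAlgEquivOfAlgebraic k E)
  have hφ : ∀ x, Θ φ x = x ^ Fintype.card k := fun x => by rw [hφ']; rfl
  refine ⟨φ, inferInstance, inferInstance, inf_le_left, fun U hU g =>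
    exists_eq_mem_ker_mul_zpow_mul hΘ hφ U hU g, fun n hn => ?_⟩
  have : Finite (G ⧸ N) := N.quotient_finite_of_isOpen hNo
  have : N.FiniteIndex := Subgroup.finiteIndex_of_finite_quotient
  -- The exponent `n * N.index` serves two purposes: an exponent `j` that it divides is a multiple
  -- of `n`, and it puts `φ ^ j` in `N`, so that `i φ ^ j ∈ N` gives `i ∈ N`.
  obtain ⟨ζ, hζ⟩ := exists_isPrimitiveRoot_card_pow_sub_one (k := k) (E := E)
    (mul_ne_zero hn this.index_ne_zero)
  let F := FiniteGaloisIntermediateField.adjoin k {ζ}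
  have hζF : ζ ∈ F.toIntermediateField := FiniteGaloisIntermediateField.subset_adjoin k {ζ} rfl
  have hker : ∀ g, g ∈ ((AlgEquiv.restrictNormalHom F).comp Θ).ker ↔
      ∀ x ∈ F.toIntermediateField, Θ g x = x := fun g => by
    rw [MonoidHom.mem_ker, AlgEquiv.ext_iff]
    constructor
    · intro h x hx
      exact (AlgEquiv.restrictNormal_commutes (Θ g) F ⟨x, hx⟩).symm.trans
        (congrArg Subtype.val (h ⟨x, hx⟩))
    · rintro h ⟨x, hx⟩
      exact Subtype.ext ((AlgEquiv.restrictNormal_commutes (Θ g) F ⟨x, hx⟩).trans (h x hx))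
  refine ⟨((AlgEquiv.restrictNormalHom F).comp Θ).ker ⊓ N, inferInstance, ?_, ?_⟩
  · have : Finite F := Module.finite_of_finite k
    refine IsOpen.inter ?_ hNo
    have : (((AlgEquiv.restrictNormalHom F).comp Θ).ker : Set G) =
        ⋂ x : F, {g : G | Θ g x = x} := by
      ext g
      simpa using hker g
    change IsOpen (((AlgEquiv.restrictNormalHom F).comp Θ).ker : Set G)
    rw [this]
    refine isOpen_iInter_of_finite fun x => ?_
    obtain ⟨V, hV, hx⟩ := hΘ x
    exact isOpen_setOf_apply_eq hV hx _
  · rintro i hi j ⟨hj1, hj2⟩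
    have h1 := (hker _).mp hj1 ζ hζF
    rw [map_mul, MonoidHom.mem_ker.mp hi, one_mul, map_zpow] at h1
    have h2 := dvd_of_zpow_apply_eq hφ (mul_ne_zero hn this.index_ne_zero) hζ h1
    push_cast at h2
    obtain ⟨c, hc⟩ := dvd_of_mul_left_dvd h2
    have h3 : φ ^ j ∈ N := by
      rw [hc, zpow_mul, zpow_natCast]
      exact N.zpow_mem (N.pow_index_mem φ) c
    exact ⟨dvd_of_mul_right_dvd h2, hi, (N.mul_mem_cancel_right h3).mp hj2⟩

end FrobeniusLifts

/-! ### Rings of integers of algebraic extensions of `ℚ_l` -/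

section IntegralClosures

open Polynomial

theorem hasFiniteQuotients_padicInt (l : ℕ) [Fact l.Prime] : Ring.HasFiniteQuotients ℤ_[l] where
  finiteQuotient {I} hI := by
    obtain ⟨n, rfl⟩ := PadicInt.ideal_eq_span_pow_p hI
    rw [← PadicInt.ker_toZModPow]
    have : NeZero (l ^ n) := ⟨pow_ne_zero _ (Fact.out : l.Prime).ne_zero⟩
    exact (RingHom.quotientKerEquivOfSurjective (ZMod.ringHom_surjective (PadicInt.toZModPow (p := l) n))).toEquiv.finite_iff.mpr
      inferInstance

/-- An element of an algebraic extension of `ℚ_l`, or its inverse, is integral over `ℤ_l`. -/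
theorem isIntegral_or_isIntegral_inv (l : ℕ) [Fact l.Prime] {E : Type*} [Field E] [Algebra ℚ_[l] E]
    [Algebra.IsAlgebraic ℚ_[l] E] (x : E) :
    IsIntegral (PadicInt.subring l) x ∨ IsIntegral (PadicInt.subring l) x⁻¹ := by
  -- Spectral norm at most `1` means that the minimal polynomial has coefficients in `ℤ_l`. The norm
  -- being multiplicative, `x` or `x⁻¹` satisfies the bound.
  have key : ∀ y : E, spectralNorm ℚ_[l] E y ≤ 1 → IsIntegral (PadicInt.subring l) y := by
    intro y hy
    have hmon := minpoly.monic (Algebra.IsIntegral.isIntegral (R := ℚ_[l]) y)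
    have hcoeff := (spectralValue_le_one_iff hmon).mp hy
    have hsub : (↑(minpoly ℚ_[l] y).coeffs : Set ℚ_[l]) ⊆ PadicInt.subring l := by
      intro c hc
      obtain ⟨n, -, rfl⟩ := mem_coeffs_iff.mp hc
      exact hcoeff n
    refine ⟨(minpoly ℚ_[l] y).toSubring _ hsub, (monic_toSubring _ _ hsub).mpr hmon, ?_⟩
    have h1 := minpoly.aeval ℚ_[l] y
    nth_rewrite 1 [← map_toSubring (minpoly ℚ_[l] y) _ hsub] at h1
    rw [aeval_def, eval₂_map] at h1
    exact h1
  rcases le_total (spectralNorm ℚ_[l] E x) 1 with h | h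
  · exact Or.inl (key x h)
  · refine Or.inr (key _ ?_)
    have h1 : spectralNorm ℚ_[l] E x⁻¹ = (spectralNorm ℚ_[l] E x)⁻¹ := map_inv₀ (spectralMulAlgNorm ℚ_[l] E) x
    rw [h1]
    exact inv_le_one_of_one_le₀ h

variable (l : ℕ) [Fact l.Prime] (K : Type*) [Field K] [Algebra ℚ_[l] K]

theorem isDedekindDomain_localIntegers [FiniteDimensional ℚ_[l] K] :
    IsDedekindDomain (LocalIntegers l K) := by
  have : IsFractionRing (PadicInt.subring l) ℚ_[l] := PadicInt.isFractionRing
  have : IsDedekindDomain (PadicInt.subring l) := inferInstanceAs (IsDedekindDomain ℤ_[l])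
  exact integralClosure.isDedekindDomain (PadicInt.subring l) ℚ_[l] K

theorem isFractionRing_localIntegers [FiniteDimensional ℚ_[l] K] :
    IsFractionRing (LocalIntegers l K) K := by
  have : IsFractionRing (PadicInt.subring l) ℚ_[l] := PadicInt.isFractionRing
  exact integralClosure.isFractionRing_of_finite_extension (A := PadicInt.subring l) ℚ_[l] K

theorem hasFiniteQuotients_localIntegers [FiniteDimensional ℚ_[l] K] :
    Ring.HasFiniteQuotients (LocalIntegers l K) := by
  have : IsFractionRing (PadicInt.subring l) ℚ_[l] := PadicInt.isFractionRing
  have : IsDedekindDomain (PadicInt.subring l) := inferInstanceAs (IsDedekindDomain ℤ_[l])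
  have : Ring.HasFiniteQuotients (PadicInt.subring l) := hasFiniteQuotients_padicInt l
  have : Module.Finite (PadicInt.subring l) (integralClosure (PadicInt.subring l) K) :=
    IsIntegralClosure.finite (PadicInt.subring l) ℚ_[l] K _
  exact Ring.HasFiniteQuotients.of_module_finite (R := PadicInt.subring l)
    (integralClosure (PadicInt.subring l) K)

variable (E : Type*) [Field E] [Algebra K E] [Algebra.IsAlgebraic K E]

/-- The ring of integers of an algebraic extension of a local field is local. -/
theorem isLocalRing_extIntegers [FiniteDimensional ℚ_[l] K] : IsLocalRing (ExtIntegers l K E) := by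
  let : Algebra ℚ_[l] E := ((algebraMap K E).comp (algebraMap ℚ_[l] K)).toAlgebra
  have : IsScalarTower ℚ_[l] K E := .of_algebraMap_eq fun _ => rfl
  have : Algebra.IsAlgebraic ℚ_[l] E := Algebra.IsAlgebraic.trans ℚ_[l] K E
  have key : ∀ x : E, IsIntegral (PadicInt.subring l) x → IsIntegral (LocalIntegers l K) x := by
    intro x hx
    exact RingHom.IsIntegralElem.of_comp
      (f := (algebraMap (PadicInt.subring l) (integralClosure (PadicInt.subring l) K)))
      (g := algebraMap (LocalIntegers l K) E) hx
  let V : ValuationSubring E :=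
    { (integralClosure (LocalIntegers l K) E).toSubring with
      mem_or_inv_mem' := fun x => (isIntegral_or_isIntegral_inv l x).imp (key x) (key _) }
  exact inferInstanceAs (IsLocalRing V)

end IntegralClosures

/-! ### Residue fields -/

section ResidueFields

open Polynomial Pointwise

/-- The residue field of an integrally closed subring of an algebraically closed field is
algebraically closed. -/
theorem isAlgClosed_of_surjective_integralClosure {A E : Type*} [CommRing A] [Field E] [Algebra A E]
    [IsAlgClosed E] {F : Type*} [Field F]
    (f : integralClosure A E →+* F) (hf : Function.Surjective f) : IsAlgClosed F := by
  refine IsAlgClosed.of_exists_root _ fun P hP hirr => ?_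
  -- A root in `E` of a monic lift is integral over `A`, so it can be reduced to a root of `P`.
  obtain ⟨Q, hQP, hdeg, hQ⟩ := lifts_and_natDegree_eq_and_monic (f := f)
    (by rw [mem_lifts]; exact map_surjective f hf P) hP
  have hd : (Q.map (integralClosure A E).val.toRingHom).degree ≠ 0 := by
    rw [hQ.degree_map, degree_eq_natDegree hQ.ne_zero, hdeg]
    exact_mod_cast hirr.natDegree_pos.ne'
  obtain ⟨x, hx⟩ := IsAlgClosed.exists_root _ hd
  have hx1 : IsIntegral (integralClosure A E) x := ⟨Q, hQ, by rwa [IsRoot, eval_map] at hx⟩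
  have hx2 : IsIntegral A x := isIntegral_trans x hx1
  refine ⟨f ⟨x, hx2⟩, ?_⟩
  rw [← hQP, eval_map, eval₂_at_apply]
  have h3 : Q.eval (⟨x, hx2⟩ : integralClosure A E) = 0 := by
    refine Subtype.ext ?_
    have h4 : (integralClosure A E).val.toRingHom (Q.eval ⟨x, hx2⟩) = 0 := by
      rw [← eval₂_at_apply, ← eval_map]
      exact hx
    exact h4
  rw [h3, map_zero]

variable (l : ℕ) [Fact l.Prime] (K : Type*) [Field K] [Algebra ℚ_[l] K] [FiniteDimensional ℚ_[l] K]
  (E : Type*) [Field E] [Algebra K E] [Algebra.IsAlgebraic K E]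

theorem isMaximal_extMaxIdeal : (extMaxIdeal l K E).IsMaximal := by
  have := isLocalRing_extIntegers l K E
  rw [extMaxIdeal, IsLocalRing.jacobson_eq_maximalIdeal _ bot_ne_top]
  infer_instance

theorem mem_extMaxIdeal_iff {x : ExtIntegers l K E} : x ∈ extMaxIdeal l K E ↔ ¬ IsUnit x := by
  have := isLocalRing_extIntegers l K E
  rw [extMaxIdeal, IsLocalRing.jacobson_eq_maximalIdeal _ bot_ne_top]
  rfl

theorem isGaloisGroup_extIntegers [IsGalois K E] :
    IsGaloisGroup Gal(E/K) (LocalIntegers l K) (ExtIntegers l K E) := by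
  have := isFractionRing_localIntegers l K
  have := isDedekindDomain_localIntegers l K
  have : Algebra.IsAlgebraic (LocalIntegers l K) E :=
    (IsFractionRing.comap_isAlgebraic_iff (A := LocalIntegers l K) (K := K)).mpr inferInstance
  have : IsFractionRing (ExtIntegers l K E) E :=
    integralClosure.isFractionRing_of_algebraic fun x hx => by
      exact Subtype.ext ((algebraMap K E).injective (hx.trans (map_zero _).symm))
  exact IsGaloisGroup.of_isFractionRing Gal(E/K) (LocalIntegers l K) (ExtIntegers l K E) K E

/-- The prime below is nonzero: otherwise the integers of `K` would form a field, and by integrality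
so would `ℤ_l`. -/
theorem finite_quotient_under_extMaxIdeal :
    Finite (LocalIntegers l K ⧸ (extMaxIdeal l K E).under (LocalIntegers l K)) := by
  have := hasFiniteQuotients_localIntegers l K
  have := isMaximal_extMaxIdeal l K E
  have hmax : ((extMaxIdeal l K E).under (LocalIntegers l K)).IsMaximal :=
    Ideal.isMaximal_comap_of_isIntegral_of_isMaximal _
  refine Ring.HasFiniteQuotients.finiteQuotient fun h => ?_
  rw [h] at hmax
  have h1 : IsField (integralClosure (PadicInt.subring l) K) :=
    Ring.isField_iff_maximal_bot.mpr hmax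
  have h2 : IsField (PadicInt.subring l) := isField_of_isIntegral_of_isField (fun x y hxy =>
    Subtype.ext ((algebraMap ℚ_[l] K).injective (congrArg Subtype.val hxy))) h1
  exact IsDiscreteValuationRing.not_isField ℤ_[l] h2

theorem smul_extMaxIdeal (g : Gal(E/K)) : g • extMaxIdeal l K E = extMaxIdeal l K E := by
  ext x
  rw [Ideal.mem_pointwise_smul_iff_inv_smul_mem, mem_extMaxIdeal_iff, mem_extMaxIdeal_iff, not_iff_not]
  exact isUnit_map_iff (MulSemiringAction.toRingEquiv Gal(E/K) (ExtIntegers l K E) g⁻¹) x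

end ResidueFields

/-! ### The action of the Galois group on the residue field -/

section GaloisAction

open Pointwise

variable (l : ℕ) [Fact l.Prime] (K : Type*) [Field K] [Algebra ℚ_[l] K] [FiniteDimensional ℚ_[l] K]
  (E : Type*) [Field E] [Algebra K E]

omit [FiniteDimensional ℚ_[l] K] in
/-- The stabilizer of a point of an algebraic extension is open. -/
theorem isOpen_stabilizer_extIntegers [Algebra.IsAlgebraic K E] (x : ExtIntegers l K E) :
    IsOpen (MulAction.stabilizer Gal(E/K) x : Set Gal(E/K)) := by
  refine Subgroup.isOpen_mono (H₁ := (IntermediateField.adjoin K {(x : E)}).fixingSubgroup)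
    (fun g hg => ?_) ?_
  · refine Subtype.ext ?_
    exact hg ⟨x, IntermediateField.mem_adjoin_simple_self K _⟩
  · have := IntermediateField.adjoin.finiteDimensional (K := K) (x := (x : E))
      (Algebra.IsIntegral.isIntegral _)
    exact IntermediateField.fixingSubgroup_isOpen _

/-- The residue field of `E` is an algebraic closure of the finite residue field of `K`. The Galois
group maps onto its automorphism group with kernel the inertia group, and the fixing subgroup of `L`
is open and normal. -/
theorem exists_isFrobeniusLift_inertia [IsAlgClosure K E] (L : IntermediateField K E)
    [FiniteDimensional K L] [Normal K L] :
    ∃ φ, IsFrobeniusLift (inertia l K E) (inertiaOver l K E L) φ := by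
  have : Algebra.IsAlgebraic K E := IsAlgClosure.isAlgebraic
  have : IsAlgClosed E := IsAlgClosure.isAlgClosed K
  have : CharZero K := charZero_of_injective_algebraMap (algebraMap ℚ_[l] K).injective
  have : Normal K E := IsAlgClosure.normal K E
  have : IsGalois K E := {}
  set m := extMaxIdeal l K E with hm
  have hmax : m.IsMaximal := isMaximal_extMaxIdeal l K E
  set P := m.under (LocalIntegers l K) with hP
  have hPmax : P.IsMaximal := Ideal.isMaximal_comap_of_isIntegral_of_isMaximal _
  have hfin : Finite (LocalIntegers l K ⧸ P) := finite_quotient_under_extMaxIdeal l K E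
  have := isGaloisGroup_extIntegers l K E
  let : Field (LocalIntegers l K ⧸ P) := Ideal.Quotient.field P
  let : Field (ExtIntegers l K E ⧸ m) := Ideal.Quotient.field m
  have : IsAlgClosed (ExtIntegers l K E ⧸ m) :=
    isAlgClosed_of_surjective_integralClosure (Ideal.Quotient.mk m) Ideal.Quotient.mk_surjective
  have : Algebra.IsIntegral (LocalIntegers l K ⧸ P) (ExtIntegers l K E ⧸ m) := inferInstance
  have : Algebra.IsAlgebraic (LocalIntegers l K ⧸ P) (ExtIntegers l K E ⧸ m) :=
    Algebra.isAlgebraic_iff_isIntegral.mpr inferInstance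
  let ι : Gal(E/K) →* MulAction.stabilizer Gal(E/K) m :=
    (MonoidHom.id Gal(E/K)).codRestrict _ fun g => smul_extMaxIdeal l K E g
  let Θ : Gal(E/K) →* Gal((ExtIntegers l K E ⧸ m)/(LocalIntegers l K ⧸ P)) :=
    (Ideal.Quotient.stabilizerHom m P Gal(E/K)).comp ι
  have hker : Θ.ker = inertia l K E := by
    ext g
    rw [MonoidHom.mem_ker, AlgEquiv.ext_iff, Ideal.Quotient.mk_surjective.forall]
    exact forall_congr' fun x => Ideal.Quotient.eq
  have hsurj : Function.Surjective Θ := by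
    -- The discrete topology makes the action continuous, since stabilizers are open; surjectivity
    -- for profinite groups requires this.
    let : TopologicalSpace (ExtIntegers l K E) := ⊥
    have : DiscreteTopology (ExtIntegers l K E) := ⟨rfl⟩
    have : ContinuousSMul Gal(E/K) (ExtIntegers l K E) :=
      continuousSMul_iff_stabilizer_isOpen.mpr (isOpen_stabilizer_extIntegers l K E)
    intro σ
    obtain ⟨g, hg⟩ := Ideal.Quotient.stabilizerHom_surjective_of_profinite P m (G := Gal(E/K)) σ
    exact ⟨g, hg⟩
  have : L.fixingSubgroup.Normal := by
    rw [← IntermediateField.restrictNormalHom_ker]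
    infer_instance
  have hopen : ∀ x, ∃ U : Subgroup Gal(E/K), IsOpen (U : Set Gal(E/K)) ∧ ∀ g ∈ U, Θ g x = x := by
    intro x
    obtain ⟨x, rfl⟩ := Ideal.Quotient.mk_surjective x
    exact ⟨_, isOpen_stabilizer_extIntegers l K E x, fun g hg =>
      congrArg (Ideal.Quotient.mk m) hg⟩
  obtain ⟨φ, hφ⟩ := exists_isFrobeniusLift_of_surjective hopen hsurj L.fixingSubgroup
    L.fixingSubgroup_isOpen
  rw [hker] at hφ
  exact ⟨φ, hφ⟩

end GaloisAction

/-! ### Inertia and the ramification index -/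

section RamificationIndex

variable (l : ℕ) [Fact l.Prime] (K : Type*) [Field K] [Algebra ℚ_[l] K] [FiniteDimensional ℚ_[l] K]
  (E : Type*) [Field E] [Algebra K E] [Algebra.IsAlgebraic K E]

theorem card_inertia_extMaxIdeal (L : Type*) [Field L] [Algebra K L] [FiniteDimensional K L]
    [IsGalois K L] : Nat.card ((extMaxIdeal l K L).inertia Gal(L/K)) = ramIndex l K L := by
  have := isFractionRing_localIntegers l K
  have := isDedekindDomain_localIntegers l K
  have := isGaloisGroup_extIntegers l K L
  have := isMaximal_extMaxIdeal l K L
  set P := (extMaxIdeal l K L).under (LocalIntegers l K) with hP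
  have hPmax : P.IsMaximal := Ideal.isMaximal_comap_of_isIntegral_of_isMaximal _
  have hfin : Finite (LocalIntegers l K ⧸ P) := finite_quotient_under_extMaxIdeal l K L
  have hlies : (extMaxIdeal l K L).LiesOver P := ⟨rfl⟩
  have : Module.Finite (LocalIntegers l K) (ExtIntegers l K L) :=
    IsIntegralClosure.finite (LocalIntegers l K) K L _
  rw [Ideal.card_inertia_eq_ramificationIdxIn P, ramIndex]
  exact Ideal.ramificationIdxIn_eq_ramificationIdx P (extMaxIdeal l K L) Gal(L/K)

variable (L : IntermediateField K E)

/-- A unit among the integers of `L` stays a unit among those of `E`, so `g x - x`, a nonunit above,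
is a nonunit below. -/
theorem restrictNormalHom_mem_inertia [Normal K L] {g : Gal(E/K)} (hg : g ∈ inertia l K E) :
    AlgEquiv.restrictNormalHom L g ∈ (extMaxIdeal l K L).inertia Gal(L/K) := by
  let j : ExtIntegers l K L →+* ExtIntegers l K E :=
    (L.val.toRingHom.comp (integralClosure (LocalIntegers l K) L).val.toRingHom).codRestrict
      (integralClosure (LocalIntegers l K) E) fun x => x.2.map
        (L.val.restrictScalars (LocalIntegers l K))
  intro x
  have h1 : g • j x - j x ∈ extMaxIdeal l K E := hg (j x)
  rw [mem_extMaxIdeal_iff] at h1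
  refine (mem_extMaxIdeal_iff l K L).mpr ?_
  intro hu
  refine h1 ?_
  have h2 : j (AlgEquiv.restrictNormalHom L g • x - x) = g • j x - j x := by
    rw [map_sub]
    refine congrArg (· - j x) (Subtype.ext ?_)
    exact AlgEquiv.restrictNormal_commutes g L x
  rw [← h2]
  exact hu.map j

/-- Restriction embeds the quotient of inertia into the inertia group of `L/K`. Divisibility is all
that coprimality needs, so surjectivity of this embedding plays no role. -/
theorem index_inertiaOver_dvd_ramIndex [FiniteDimensional K L] [IsGalois K L] :
    ((inertiaOver l K E L).subgroupOf (inertia l K E)).index ∣ ramIndex l K L := by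
  let f : inertia l K E →* Gal(L/K) :=
    (AlgEquiv.restrictNormalHom L).comp (inertia l K E).subtype
  have hker : f.ker = (inertiaOver l K E L).subgroupOf (inertia l K E) := by
    ext g
    have h1 : (AlgEquiv.restrictNormalHom L (g : Gal(E/K)) = 1) ↔ (g : Gal(E/K)) ∈ L.fixingSubgroup := by
      rw [← IntermediateField.restrictNormalHom_ker, MonoidHom.mem_ker]
    exact h1.trans ⟨fun h => ⟨g.2, h⟩, fun h => h.2⟩
  rw [← hker, Subgroup.index_ker, ← card_inertia_extMaxIdeal]
  refine Subgroup.card_dvd_of_le ?_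
  rintro _ ⟨g, rfl⟩
  exact restrictNormalHom_mem_inertia l K E L g.2

end RamificationIndex

end FramedDef

theorem theorem2
    (l p : ℕ) [Fact l.Prime] [Fact p.Prime] (_hlp : l ≠ p)
    -- the local field `K`, an algebraic closure of it, and the coefficient field
    (K : Type*) [Field K] [Algebra ℚ_[l] K] [FiniteDimensional ℚ_[l] K]
    (Kbar : Type*) [Field Kbar] [Algebra K Kbar] [IsAlgClosure K Kbar]
    (𝔽 : Type u) [Field 𝔽] [Finite 𝔽] [CharP 𝔽 p]
    -- the residual representation, with its basis
    {d : ℕ} (V : Type*) [AddCommGroup V] [Module 𝔽 V] (β : Module.Basis (Fin d) 𝔽 V)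
    (ρbar : Representation 𝔽 Gal(Kbar/K) V)
    (_hρbar : ∀ v : V, IsOpen {g : Gal(Kbar/K) | ρbar g v = v})
    -- the universal framed deformation ring, with the universal framed deformation
    (R : Type u) [CommRing R] [Algebra (WittVector p 𝔽) R] (π : R →+* 𝔽)
    (r : Gal(Kbar/K) →* Matrix (Fin d) (Fin d) R)
    (_hR : FramedDef.IsUniversalFramedDeformation p ρbar β π r)
    -- the `p`-adic tame character of inertia, and the universal monodromy operator
    (t : FramedDef.inertia l K Kbar →* Multiplicative ℤ_[p])
    (_htcont : Continuous t) (_htsurj : Function.Surjective t)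
    (N : Matrix (Fin d) (Fin d) (Localization.Away (p : R)))
    (_hN : FramedDef.IsMonodromyOperator p 𝔽 t r N)
    -- the quotient of the universal ring on which monodromy vanishes is `R ⧸ J`; it is not zero
    (J : Ideal R) (_hJ : FramedDef.CutsOutVanishing p N J) (_hJ_ne : J ≠ ⊤)
    -- the action of inertia on the universal deformation over `R ⧸ J` factors through `I_{L/K}`
    (L : IntermediateField K Kbar) [FiniteDimensional K L] [IsGalois K L]
    (_hL : ∀ σ ∈ FramedDef.inertiaOver l K Kbar L, (r σ).map (Ideal.Quotient.mk J) = 1)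
    -- the ramification index of `L/K` is prime to `p`
    (_htame : (FramedDef.ramIndex l K L).Coprime p) :
    FramedDef.IsFormallySmoothOfRelDim p 𝔽 (R ⧸ J) (d ^ 2) := by
  have : Algebra.IsAlgebraic K Kbar := IsAlgClosure.isAlgebraic
  have : CharZero K := charZero_of_injective_algebraMap (algebraMap ℚ_[l] K).injective
  have : Normal K Kbar := IsAlgClosure.normal K Kbar
  have : IsGalois K Kbar := {}
  obtain ⟨φ, hφ⟩ := FramedDef.exists_isFrobeniusLift_inertia l K Kbar L
  have hdvd := FramedDef.index_inertiaOver_dvd_ramIndex l K Kbar L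
  have hcop := Nat.Coprime.of_dvd_left hdvd _htame
  -- Infinite index is encoded as `0`, which is coprime to `p` only if `p = 1`.
  have : ((FramedDef.inertiaOver l K Kbar L).subgroupOf (FramedDef.inertia l K Kbar)).FiniteIndex :=
    ⟨fun h0 => (Fact.out : p.Prime).ne_one (by rwa [h0, Nat.coprime_zero_left] at hcop)⟩
  exact FramedDef.isFormallySmoothOfRelDim_of_isFrobeniusLift hφ hcop _hR _htsurj _hN _hJ _hJ_ne _hL
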